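/- Let $H$ be a Polish space, $\mathcal P(H)$ the space of Borel probability measures on $H$ with the topology of weak convergence, and $(\mathcal R_\tau)_{\tau\ge 0}$ a continuous semigroup on $H$: $\mathcal R_0=\mathrm{Id}$, $\mathcal R_{\tau+\tau'}=\mathcal R_\tau\circ\mathcal R_{\tau'}$, each $\mathcal R_\tau$ is continuous, and each orbit $\tau\mapsto\mathcal R_\tau y$ is continuous. Let $K\subset H$ be compact with $\mathcal R_\tau K\subset K$ for all $\tau\ge0$, and absorbing: for every $y\in H$ there is $T$ with $\mathcal R_\tau y\in K$ for all $\tau\ge T$. Let $\mathcal P(K)$ be the set of $\mu\in\mathcal P(H)$ with $\mu(K)=1$. For $\mu\in\mathcal P(H)$ and $r>0$ put $\mu_r(\mu)=\frac1r\int_0^r(\mathcal R_\tau)_\#\mu\,d\tau$, and let the Birkhoff $\omega$-limit set be $$\omega(\mu)=\bigcap_{r>0}\overline{\{\mu_{r'}(\mu): r'\ge r\}}.$$ A set $\mathcal A\subset\mathcal P(H)$ is a statistical attractor for $(\mathcal R_\tau)_\#$ if it is non-empty and compact, satisfies $(\mathcal R_\tau)_\#\mathcal A\subset\mathcal A$ for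 all $\tau\ge0$, and there is $\nu\in\mathcal P(H)$ with $\omega(\nu)\subset\mathcal A$. For $y\in H$ let $\mathcal M(y)$ be the set of all weak limits of $\frac1{\tau_n}\int_0^{\tau_n}\delta_{\mathcal R_\tau y}\,d\tau$ along sequences $\tau_n\to\infty$. Put $$\mathcal M_{\mathcal R}=\bigcup_{y\in H}\omega(\delta_y),\qquad \mathcal M_{\mathcal R}^\#=\bigcup_{\mu\in\mathcal P(H)}\omega(\mu),\qquad \mathrm{Inv}(\mathcal R)=\{\eta\in\mathcal P(K): (\mathcal R_\tau)_\#\eta=\eta\ \ \forall\tau\ge0\},$$ $$\mathcal E_{\mathcal R}=\{\mu\in\mathcal P(H): \omega(\delta_y)=\{\mu\}\ \text{for }\mu\text{-a.e. }y\}.$$ Then: (i) For every $\mu\in\mathcal P(K)$, $\omega(\mu)$ is non-empty, compact and forward-invariant under $(\mathcal R_\tau)_\#$, and it is a statistical attractor. (ii) $\omega(\delta_y)=\mathcal M(y)$ for every $y\in H$, so $\mathcal M_{\mathcal R}=\bigcup_{y\in H}\mathcal M(y)$. The set $\mathcal E_{\mathcal R}$ is the set of ergodic measures of $\mathcal R$,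 i.e. of those invariant $\mu\in\mathcal P(H)$ for which $\mu(A)\in\{0,1\}$ for every Borel set $A$ with $\mathcal R_\tau^{-1}A=A$ for all $\tau\ge0$. Moreover $$\mathcal E_{\mathcal R}\subset\mathcal M_{\mathcal R}\subset\mathcal M_{\mathcal R}^\#=\mathrm{Inv}(\mathcal R)=\overline{\mathrm{co}}(\mathcal E_{\mathcal R}),$$ and $\mathcal M_{\mathcal R}^\#$ is a compact and convex subset of $\mathcal P(H)$. In general $\mathcal M_{\mathcal R}$ is neither closed nor convex: there is such a semigroup on $\mathbb C$, with a compact forward-invariant absorbing set, for which $\mathcal M_{\mathcal R}$ is neither closed in $\mathcal P(\mathbb C)$ nor convex. -/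

import Mathlib

open MeasureTheory Filter Topology Set
open scoped NNReal ENNReal BoundedContinuousFunction

universe u

/-- A continuous semigroup `(S_τ)_{τ ≥ 0}` on a topological space `X`: `S₀ = id`,
`S_{s+t} = S_s ∘ S_t`, every `S_t` is continuous, and every orbit `t ↦ S_t x` is continuous.
(Joint continuity in `(t, x)` is not required.) -/
structure ContinuousSemigroup (X : Type u) [TopologicalSpace X] where
  toFun : ℝ≥0 → X → X
  map_zero' : toFun 0 = id
  map_add' : ∀ s t : ℝ≥0, toFun (s + t) = toFun s ∘ toFun t
  continuous_map : ∀ t : ℝ≥0, Continuous (toFun t)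
  continuous_orbit : ∀ x : X, Continuous fun t : ℝ≥0 => toFun t x

namespace ContinuousSemigroup

instance {X : Type u} [TopologicalSpace X] :
    CoeFun (ContinuousSemigroup X) (fun _ => ℝ≥0 → X → X) := ⟨toFun⟩

/-- `K` is absorbing: every orbit enters `K` in finite time and stays there. (Sets that absorb
every bounded set in finite time are absorbing in this sense.) -/
def IsAbsorbing {X : Type u} [TopologicalSpace X] (R : ContinuousSemigroup X) (K : Set X) : Prop :=
  ∀ y : X, ∃ T : ℝ≥0, ∀ τ : ℝ≥0, T ≤ τ → R τ y ∈ K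

/-- `A` is forward-invariant: `S_τ A ⊆ A` for all `τ ≥ 0`. -/
def IsForwardInvariant {X : Type u} [TopologicalSpace X] (S : ContinuousSemigroup X)
    (A : Set X) : Prop :=
  ∀ τ : ℝ≥0, S τ '' A ⊆ A

section Pushforward

variable {X : Type u} [TopologicalSpace X] [MeasurableSpace X] [BorelSpace X]

/-- The pushforward semigroup `(R_τ)_#` on Borel probability measures, endowed with the
topology of weak convergence. -/
noncomputable def pushforward (R : ContinuousSemigroup X) :
    ContinuousSemigroup (ProbabilityMeasure X) where
  toFun τ μ := μ.map (R.continuous_map τ).measurable.aemeasurable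
  map_zero' := by
    funext μ
    apply Subtype.ext
    change Measure.map (R.toFun 0) (μ : Measure X) = μ
    rw [R.map_zero', Measure.map_id]
  map_add' s t := by
    funext μ
    apply Subtype.ext
    change Measure.map (R.toFun (s + t)) (μ : Measure X)
      = Measure.map (R.toFun s) (Measure.map (R.toFun t) (μ : Measure X))
    rw [Measure.map_map (R.continuous_map s).measurable (R.continuous_map t).measurable,
      R.map_add']
  continuous_map t := ProbabilityMeasure.continuous_map (R.continuous_map t)
  continuous_orbit μ := by
    rw [ProbabilityMeasure.continuous_iff_forall_continuous_integral]
    intro F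
    have h : ∀ t : ℝ≥0, ∫ x, F x ∂(Measure.map (R.toFun t) (μ : Measure X))
        = ∫ x, F (R.toFun t x) ∂(μ : Measure X) := fun t =>
      integral_map (R.continuous_map t).measurable.aemeasurable
        F.continuous.measurable.aestronglyMeasurable
    change Continuous fun t : ℝ≥0 => ∫ x, F x ∂(Measure.map (R.toFun t) (μ : Measure X))
    simp_rw [h]
    refine continuous_of_dominated (bound := fun _ => ‖F‖) ?_ ?_ (integrable_const _) ?_
    · intro t
      exact (F.continuous.comp (R.continuous_map t)).measurable.aestronglyMeasurable
    · intro t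
      exact Eventually.of_forall fun x => F.norm_coe_le_norm _
    · exact Eventually.of_forall fun x => F.continuous.comp (R.continuous_orbit x)

end Pushforward

section Birkhoff

variable {X : Type u} [TopologicalSpace X] [HasOuterApproxClosed X] [MeasurableSpace X]
  [BorelSpace X]

/-- Weakly continuous curves of probability measures are measurable. -/
theorem measurable_curve (c : ℝ≥0 → ProbabilityMeasure X) (hc : Continuous c) :
    Measurable fun t : ℝ≥0 => (c t : Measure X) := by
  refine Measurable.measure_of_isPiSystem_of_isProbabilityMeasure
    ((BorelSpace.measurable_eq (α := X)).trans (borel_eq_generateFrom_isClosed (α := X)))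
    isPiSystem_isClosed ?_
  intro F hF
  have hF' : IsClosed F := hF
  refine measurable_of_tendsto_metrizable
    (f := fun (n : ℕ) (t : ℝ≥0) => ∫⁻ x, hF'.apprSeq n x ∂(c t : Measure X)) ?_ ?_
  · intro n
    exact ((ProbabilityMeasure.continuous_lintegral_boundedContinuousFunction
      (hF'.apprSeq n)).comp hc).measurable
  · rw [tendsto_pi_nhds]
    intro t
    exact HasOuterApproxClosed.tendsto_lintegral_apprSeq hF' _

/-- The time average `(1 / r) ∫₀^r S_τ ν dτ`, as a Borel probability measure: its value on a
Borel set `B` is `(1 / r) ∫₀^r (S_τ ν)(B) dτ`. -/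
noncomputable def timeAverage (S : ContinuousSemigroup (ProbabilityMeasure X))
    (ν : ProbabilityMeasure X) (r : ℝ) (hr : 0 < r) : ProbabilityMeasure X :=
  ⟨((ENNReal.ofReal r)⁻¹ • (volume : Measure ℝ).restrict (Icc 0 r)).bind
      (fun τ => (S τ.toNNReal ν : Measure X)), by
    have hp : IsProbabilityMeasure
        ((ENNReal.ofReal r)⁻¹ • (volume : Measure ℝ).restrict (Icc 0 r)) := by
      constructor
      have h0 : ENNReal.ofReal r ≠ 0 := by simpa using hr
      simp [ENNReal.inv_mul_cancel h0 ENNReal.ofReal_ne_top]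
    have hm : Measurable fun τ : ℝ => (S τ.toNNReal ν : Measure X) :=
      (measurable_curve _ (S.continuous_orbit ν)).comp measurable_real_toNNReal
    exact isProbabilityMeasure_bind hm.aemeasurable
      (Eventually.of_forall fun τ => inferInstance)⟩

/-- The Birkhoff `ω`-limit set: `⋂_{r > 0} closure {(1 / r') ∫₀^{r'} S_τ ν dτ : r' ≥ r}`. -/
noncomputable def omegaBirkhoff (S : ContinuousSemigroup (ProbabilityMeasure X))
    (ν : ProbabilityMeasure X) : Set (ProbabilityMeasure X) :=
  ⋂ (r : ℝ) (_ : 0 < r),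
    closure {ρ | ∃ (r' : ℝ) (h : 0 < r'), r ≤ r' ∧ ρ = timeAverage S ν r' h}

/-- The Birkhoff basin of attraction of `A`. -/
def birkhoffBasin (S : ContinuousSemigroup (ProbabilityMeasure X))
    (A : Set (ProbabilityMeasure X)) : Set (ProbabilityMeasure X) :=
  {ν | omegaBirkhoff S ν ⊆ A}

/-- Statistical attractors of a continuous semigroup on probability measures: nonempty, weakly
compact, forward-invariant, and with nonempty Birkhoff basin of attraction. -/
structure IsStatisticalAttractor (S : ContinuousSemigroup (ProbabilityMeasure X))
    (A : Set (ProbabilityMeasure X)) : Prop where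
  nonempty : A.Nonempty
  isCompact : IsCompact A
  forwardInvariant : S.IsForwardInvariant A
  attraction : (birkhoffBasin S A).Nonempty

/-- `ω(μ)`: the Birkhoff `ω`-limit set of `μ` for the pushforward semigroup `(R_τ)_#`. -/
noncomputable def omegaMeasure (R : ContinuousSemigroup X) (μ : ProbabilityMeasure X) :
    Set (ProbabilityMeasure X) :=
  omegaBirkhoff R.pushforward μ

/-- `M(y)`: the weak limits of `(1 / τ_n) ∫₀^{τ_n} δ_{R_τ y} dτ` along sequences `τ_n → ∞`. -/
def limitMeasures (R : ContinuousSemigroup X) (y : X) : Set (ProbabilityMeasure X) :=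
  {μ | ∃ τ : ℕ → ℝ, Tendsto τ atTop atTop ∧ ∀ F : X →ᵇ ℝ,
    Tendsto (fun n => (τ n)⁻¹ * ∫ s in (0 : ℝ)..τ n, F (R s.toNNReal y)) atTop
      (𝓝 (∫ x, F x ∂(μ : Measure X)))}

/-- `M_R = ⋃_{y} ω(δ_y)`. -/
noncomputable def pointLimits (R : ContinuousSemigroup X) : Set (ProbabilityMeasure X) :=
  ⋃ y : X, R.omegaMeasure (diracProba y)

/-- `M_R^# = ⋃_{μ} ω(μ)`, over all Borel probability measures on the whole space. -/
noncomputable def measureLimits (R : ContinuousSemigroup X) : Set (ProbabilityMeasure X) :=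
  ⋃ μ : ProbabilityMeasure X, R.omegaMeasure μ

/-- `E_R`: the `μ` with `ω(δ_y) = {μ}` for `μ`-almost every `y`. -/
def ergodicSet (R : ContinuousSemigroup X) : Set (ProbabilityMeasure X) :=
  {μ | ∀ᵐ y ∂(μ : Measure X), R.omegaMeasure (diracProba y) = {μ}}

end Birkhoff

section Measures

variable {X : Type u} [TopologicalSpace X] [MeasurableSpace X] [BorelSpace X]

/-- `Inv(R)`: the invariant probability measures carried by `K`. -/
def invariantMeasures (R : ContinuousSemigroup X) (K : Set X) : Set (ProbabilityMeasure X) :=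
  {η | (η : Measure X) K = 1 ∧ ∀ τ : ℝ≥0, R.pushforward τ η = η}

/-- Ergodic measures in the classical sense: `μ` is invariant and every Borel set `A` with
`R_τ⁻¹ A = A` for all `τ ≥ 0` satisfies `μ A ∈ {0, 1}`. -/
def IsErgodicMeasure (R : ContinuousSemigroup X) (μ : ProbabilityMeasure X) : Prop :=
  (∀ τ : ℝ≥0, R.pushforward τ μ = μ) ∧
    ∀ A : Set X, MeasurableSet A → (∀ τ : ℝ≥0, R τ ⁻¹' A = A) →
      (μ : Measure X) A = 0 ∨ (μ : Measure X) A = 1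

end Measures

end ContinuousSemigroup

namespace MeasureTheory.ProbabilityMeasure

variable {X : Type u} [TopologicalSpace X] [MeasurableSpace X] [OpensMeasurableSpace X]

/-- A set of probability measures is convex if it is convex as a set of finite measures. -/
def IsConvexSet (A : Set (ProbabilityMeasure X)) : Prop :=
  Convex ℝ≥0 (toFiniteMeasure '' A)

/-- `closure (co A)`: the closure, for weak convergence of probability measures, of the set of
finite convex combinations of elements of `A`. -/
def closedHull (A : Set (ProbabilityMeasure X)) : Set (ProbabilityMeasure X) :=
  closure (toFiniteMeasure ⁻¹' convexHull ℝ≥0 (toFiniteMeasure '' A))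

end MeasureTheory.ProbabilityMeasure

/-! Since weak convergence on a Polish space is first countable, `ω(ν)` consists of the sequential
limits of time averages. Averages over `[0, r]` and `[t, r + t]` differ by `O(t / r)`, so every
limit is invariant. Because almost every orbit eventually enters `K`, dominated convergence puts
every limit on `K`, even for `ν` not carried by `K`. Conversely, the averages of an invariant
measure are constant, so `ω(ν) = {ν}`. Hence the union of all `ω(ν)` is exactly the set of invariant
measures on `K`, a closed and convex part of the compact set of measures carried by `K`. Existence
of limits for measures on `K` is the same compactness.

If `ω(δ_y) = {μ}` for almost every `y`, integrating the time averages over an invariant set `A`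
gives `∫_A F dμ = μ(A) ∫ F dμ` for all `F`, whence `μ(A) = μ(A)²`. The converse is the pointwise
ergodic theorem, derived from the maximal ergodic theorem for the time-one map and then applied to
countably many test functions separating measures on `K`.

For the closed hull, probability measures are embedded in the locally convex space of functions on
the bounded continuous functions, where the Krein–Milman theorem applies. An extreme invariant
measure is ergodic, since conditioning on an invariant set of intermediate measure would split it
(`isErgodicMeasure_of_mem_extremePoints`).

The counterexample rotates circles of radius below one and fixes the unit circle pointwise. Point
limits on the unit circle are Dirac masses, so midpoints of two of them are missing; so are limits
of the rotation-invariant measures on the inner circles. -/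

/-! ### Time averages of functions on the half-line -/

/-- Cesàro means of a bounded measurable function converge to its limit at infinity. -/
theorem tendsto_interval_average {g : ℝ → ℝ} {c C : ℝ} (hg : Measurable g)
    (hC : ∀ s, |g s| ≤ C) (h : Tendsto g atTop (𝓝 c)) :
    Tendsto (fun r : ℝ => r⁻¹ * ∫ s in (0 : ℝ)..r, g s) atTop (𝓝 c) := by
  -- Rescaling to the fixed interval `[0, 1]` reduces the claim to dominated convergence.
  have key : Tendsto (fun r : ℝ => ∫ s in (0 : ℝ)..1, g (r * s)) atTop
      (𝓝 (∫ _s in (0 : ℝ)..1, c)) := by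
    refine intervalIntegral.tendsto_integral_filter_of_dominated_convergence (fun _ => C)
      (Eventually.of_forall fun r => ?_) (Eventually.of_forall fun r => ?_) (by simp) ?_
    · exact (hg.comp (measurable_const_mul r)).aestronglyMeasurable
    · exact Eventually.of_forall fun s _ => hC _
    · refine Eventually.of_forall fun s hs => h.comp ?_
      rw [uIoc_of_le zero_le_one] at hs
      exact tendsto_id.atTop_mul_const hs.1
  simp only [intervalIntegral.integral_const, sub_zero, one_smul] at key
  refine key.congr' ?_
  filter_upwards [eventually_gt_atTop 0] with r hr
  rw [intervalIntegral.integral_comp_mul_left g hr.ne']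
  simp

/-- Time averages of a bounded continuous function over `[0, r]` and `[t, r + t]` are
asymptotically equal. -/
theorem tendsto_interval_average_shift_sub {g : ℝ → ℝ} {C : ℝ} (hg : Continuous g)
    (hC : ∀ s, |g s| ≤ C) (t : ℝ) :
    Tendsto (fun r : ℝ => (r⁻¹ * ∫ s in (0 : ℝ)..r, g (s + t)) - r⁻¹ * ∫ s in (0 : ℝ)..r, g s)
      atTop (𝓝 0) := by
  have hi : ∀ a b, IntervalIntegrable g volume a b := fun a b => hg.intervalIntegrable a b
  have hb : ∀ r : ℝ, |(∫ s in (0 : ℝ)..r, g (s + t)) - ∫ s in (0 : ℝ)..r, g s| ≤ 2 * C * |t| := by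
    intro r
    rw [intervalIntegral.integral_comp_add_right, zero_add]
    -- The overlap cancels, leaving two end intervals of length `|t|`.
    have h1 : (∫ s in t..r + t, g s) - ∫ s in (0 : ℝ)..r, g s
        = (∫ s in r..r + t, g s) - ∫ s in (0 : ℝ)..t, g s := by
      rw [← intervalIntegral.integral_add_adjacent_intervals (hi 0 t) (hi t r),
        ← intervalIntegral.integral_add_adjacent_intervals (hi t r) (hi r (r + t))]
      ring
    rw [h1]
    have h2 := intervalIntegral.norm_integral_le_of_norm_le_const (a := r) (b := r + t)
      (f := g) (C := C) fun s _ => hC s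
    have h3 := intervalIntegral.norm_integral_le_of_norm_le_const (a := 0) (b := t)
      (f := g) (C := C) fun s _ => hC s
    rw [add_sub_cancel_left, Real.norm_eq_abs] at h2
    rw [sub_zero, Real.norm_eq_abs] at h3
    refine (abs_sub_le_iff.2 ⟨?_, ?_⟩) <;>
      linarith [(abs_le.1 h2).1, (abs_le.1 h2).2, (abs_le.1 h3).1, (abs_le.1 h3).2]
  have h0 : Tendsto (fun r : ℝ => r⁻¹ * (2 * C * |t|)) atTop (𝓝 0) := by
    simpa using tendsto_inv_atTop_zero.mul_const (2 * C * |t|)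
  refine squeeze_zero_norm' ?_ h0
  filter_upwards [eventually_gt_atTop 0] with r hr
  rw [← mul_sub, norm_mul, Real.norm_eq_abs, Real.norm_eq_abs, abs_of_pos (inv_pos.2 hr)]
  exact mul_le_mul_of_nonneg_left (hb r) (inv_pos.2 hr).le

theorem MeasureTheory.ProbabilityMeasure.ext_of_integral_eq {X : Type u}
    [TopologicalSpace X] [PolishSpace X] [MeasurableSpace X] [BorelSpace X]
    {μ ν : ProbabilityMeasure X}
    (h : ∀ F : X →ᵇ ℝ, ∫ x, F x ∂(μ : Measure X) = ∫ x, F x ∂(ν : Measure X)) : μ = ν :=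
  ProbabilityMeasure.toMeasure_injective (ext_of_forall_integral_eq_of_IsFiniteMeasure h)

/-! ### Limits of time averages: sequences, invariance, support -/

namespace ContinuousSemigroup

section

variable {X : Type u} [TopologicalSpace X]

theorem apply_add (R : ContinuousSemigroup X) (s t : ℝ≥0) (x : X) : R (s + t) x = R s (R t x) :=
  congrFun (R.map_add' s t) x

variable [MeasurableSpace X]

theorem integral_apply_apply (R : ContinuousSemigroup X) (t : ℝ≥0) (F : X →ᵇ ℝ)
    (ν : Measure X) (s : ℝ≥0) :
    ∫ x, F (R t (R s x)) ∂ν = ∫ x, F (R (s + t) x) ∂ν := by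
  simp_rw [add_comm s t, apply_add]

variable [BorelSpace X]

theorem coe_pushforward (R : ContinuousSemigroup X) (t : ℝ≥0) (ν : ProbabilityMeasure X) :
    (R.pushforward t ν : Measure X) = (ν : Measure X).map (R t) := rfl

theorem integral_pushforward (R : ContinuousSemigroup X) (t : ℝ≥0) (ν : ProbabilityMeasure X)
    (F : X →ᵇ ℝ) :
    ∫ x, F x ∂(R.pushforward t ν : Measure X) = ∫ x, F (R t x) ∂(ν : Measure X) :=
  integral_map (R.continuous_map t).measurable.aemeasurable
    F.continuous.measurable.aestronglyMeasurable

theorem continuous_integral_orbit (R : ContinuousSemigroup X) (ν : ProbabilityMeasure X)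
    (F : X →ᵇ ℝ) : Continuous fun s : ℝ => ∫ x, F (R s.toNNReal x) ∂(ν : Measure X) := by
  simp_rw [← integral_pushforward]
  exact ((ProbabilityMeasure.continuous_integral_boundedContinuousFunction F).comp
    (R.pushforward.continuous_orbit ν)).comp continuous_real_toNNReal

theorem abs_integral_orbit_le (R : ContinuousSemigroup X) (ν : ProbabilityMeasure X)
    (F : X →ᵇ ℝ) (t : ℝ≥0) : |∫ x, F (R t x) ∂(ν : Measure X)| ≤ ‖F‖ := by
  rw [← integral_pushforward, ← Real.norm_eq_abs]
  exact F.norm_integral_le_norm _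

end

section

variable {X : Type u} [TopologicalSpace X] [PolishSpace X] [MeasurableSpace X] [BorelSpace X]

/-- Continuity in time and measurability in space already give joint measurability, which the Fubini
arguments need in the absence of joint continuity. -/
theorem measurable_uncurry (R : ContinuousSemigroup X) :
    Measurable fun p : ℝ≥0 × X => R p.1 p.2 := by
  let := TopologicalSpace.upgradeIsCompletelyMetrizable X
  exact (measurable_uncurry_of_continuous_of_measurable (u := fun t x => R t x)
    (fun x => R.continuous_orbit x) (fun t => (R.continuous_map t).measurable))

theorem measurable_uncurry_toNNReal (R : ContinuousSemigroup X) :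
    Measurable fun p : ℝ × X => R p.1.toNNReal p.2 :=
  R.measurable_uncurry.comp
    ((measurable_real_toNNReal.comp measurable_fst).prodMk measurable_snd)

theorem integral_timeAverage (S : ContinuousSemigroup (ProbabilityMeasure X))
    (ν : ProbabilityMeasure X) {r : ℝ} (hr : 0 < r) (F : X →ᵇ ℝ) :
    ∫ x, F x ∂(timeAverage S ν r hr : Measure X)
      = r⁻¹ * ∫ s in (0 : ℝ)..r, ∫ x, F x ∂(S s.toNNReal ν : Measure X) := by
  let m : Measure ℝ := (ENNReal.ofReal r)⁻¹ • (volume : Measure ℝ).restrict (Icc 0 r)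
  let κ : ProbabilityTheory.Kernel ℝ X := ⟨fun τ => (S τ.toNNReal ν : Measure X),
    (measurable_curve _ (S.continuous_orbit ν)).comp measurable_real_toNNReal⟩
  have hint : Integrable F ((κ.comp (ProbabilityTheory.Kernel.const Unit m)) ()) := by
    have : IsProbabilityMeasure ((κ.comp (ProbabilityTheory.Kernel.const Unit m)) ()) := by
      rw [ProbabilityTheory.Kernel.comp_apply]
      exact (timeAverage S ν r hr).2
    exact F.integrable _
  have h := ProbabilityTheory.Kernel.integral_comp hint
  rw [ProbabilityTheory.Kernel.comp_apply] at h
  refine (h.trans ?_)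
  rw [ProbabilityTheory.Kernel.const_apply, integral_smul_measure,
    intervalIntegral.integral_of_le hr.le, integral_Icc_eq_integral_Ioc, ENNReal.toReal_inv,
    ENNReal.toReal_ofReal hr.le]
  rfl

/-- The time average of length `r`, extended by `ν` to `r ≤ 0`. -/
noncomputable def average (S : ContinuousSemigroup (ProbabilityMeasure X))
    (ν : ProbabilityMeasure X) (r : ℝ) : ProbabilityMeasure X :=
  if h : 0 < r then timeAverage S ν r h else ν

theorem average_of_pos (S : ContinuousSemigroup (ProbabilityMeasure X))
    (ν : ProbabilityMeasure X) {r : ℝ} (hr : 0 < r) : average S ν r = timeAverage S ν r hr :=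
  dif_pos hr

/-- The half-lines `[r, ∞)` with `r ≥ 1` form a basis of `atTop`, so the values of `average` at
nonpositive lengths play no role. -/
theorem mem_omegaBirkhoff_iff {S : ContinuousSemigroup (ProbabilityMeasure X)}
    {ν ρ : ProbabilityMeasure X} :
    ρ ∈ omegaBirkhoff S ν ↔ MapClusterPt ρ atTop (average S ν) := by
  have hset : ∀ r : ℝ, 0 < r →
      {ρ | ∃ (r' : ℝ) (h : 0 < r'), r ≤ r' ∧ ρ = timeAverage S ν r' h}
        = average S ν '' Ici r := by
    intro r hr
    ext ρ
    constructor
    · rintro ⟨r', h, hle, rfl⟩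
      exact ⟨r', hle, average_of_pos S ν h⟩
    · rintro ⟨r', hle, rfl⟩
      exact ⟨r', hr.trans_le hle, hle, average_of_pos S ν _⟩
  rw [MapClusterPt, ((atTop_basis' (1 : ℝ)).map (average S ν)).clusterPt_iff_forall_mem_closure]
  simp only [omegaBirkhoff, mem_iInter]
  constructor
  · intro h r hr
    rw [← hset r (zero_lt_one.trans_le hr)]
    exact h r (zero_lt_one.trans_le hr)
  · intro h r hr
    rw [hset r hr]
    exact closure_mono (image_mono (Ici_subset_Ici.2 (le_max_left r 1)))
      (h (max r 1) (le_max_right r 1))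

theorem mem_omegaMeasure_iff {R : ContinuousSemigroup X} {ν ρ : ProbabilityMeasure X} :
    ρ ∈ R.omegaMeasure ν ↔ ∃ τ : ℕ → ℝ, Tendsto τ atTop atTop ∧ ∀ F : X →ᵇ ℝ,
      Tendsto (fun n => (τ n)⁻¹ * ∫ s in (0 : ℝ)..τ n, ∫ x, F (R s.toNNReal x) ∂(ν : Measure X))
        atTop (𝓝 (∫ x, F x ∂(ρ : Measure X))) := by
  have hint : ∀ τ : ℕ → ℝ, Tendsto τ atTop atTop → (
      Tendsto (fun n => average R.pushforward ν (τ n)) atTop (𝓝 ρ) ↔ ∀ F : X →ᵇ ℝ,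
      Tendsto (fun n => (τ n)⁻¹ * ∫ s in (0 : ℝ)..τ n, ∫ x, F (R s.toNNReal x) ∂(ν : Measure X))
        atTop (𝓝 (∫ x, F x ∂(ρ : Measure X)))) := by
    intro τ hτ
    rw [ProbabilityMeasure.tendsto_iff_forall_integral_tendsto]
    refine forall_congr' fun F => tendsto_congr' ?_
    filter_upwards [hτ.eventually_gt_atTop 0] with n hn
    rw [average_of_pos _ _ hn, integral_timeAverage]
    simp_rw [integral_pushforward]
  rw [omegaMeasure, mem_omegaBirkhoff_iff]
  constructor
  · intro h
    obtain ⟨τ, h2, h1⟩ := h.exists_seq_tendsto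
    exact ⟨τ, h1, (hint τ h1).1 h2⟩
  · rintro ⟨τ, h1, h2⟩
    exact MapClusterPt.of_comp h1 ((hint τ h1).2 h2).mapClusterPt

theorem omegaMeasure_dirac (R : ContinuousSemigroup X) (y : X) :
    R.omegaMeasure (diracProba y) = R.limitMeasures y := by
  ext ρ
  rw [mem_omegaMeasure_iff, limitMeasures, mem_ofPred_eq]
  refine exists_congr fun τ => and_congr_right fun _ => forall_congr' fun F => ?_
  have : ∀ s : ℝ, ∫ x, F (R s.toNNReal x) ∂(diracProba y : Measure X) = F (R s.toNNReal y) :=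
    fun s => integral_dirac (fun x => F (R s.toNNReal x)) y
  simp_rw [this]

/-- The Krylov–Bogolyubov argument: testing against `F ∘ R t` shifts the window of the time average
by `t`, which does not affect the limit. -/
theorem pushforward_eq_of_mem_omegaMeasure {R : ContinuousSemigroup X}
    {ν η : ProbabilityMeasure X} (h : η ∈ R.omegaMeasure ν) (t : ℝ≥0) :
    R.pushforward t η = η := by
  obtain ⟨τ, hτ, hF⟩ := mem_omegaMeasure_iff.1 h
  refine ProbabilityMeasure.ext_of_integral_eq fun F => ?_
  rw [integral_pushforward]
  have h1 := hF (F.compContinuous ⟨R t, R.continuous_map t⟩)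
  have h2 := (tendsto_interval_average_shift_sub (R.continuous_integral_orbit ν F)
    (fun s => R.abs_integral_orbit_le ν F s.toNNReal) (t : ℝ)).comp hτ
  have h3 := (hF F).add h2
  rw [add_zero] at h3
  refine tendsto_nhds_unique h1 (h3.congr' ?_)
  filter_upwards [hτ.eventually_ge_atTop 0] with n hn
  simp only [Function.comp_apply, add_sub_cancel]
  congr 1
  refine intervalIntegral.integral_congr fun s hs => ?_
  rw [uIcc_of_le hn] at hs
  simp only [BoundedContinuousFunction.compContinuous_apply, ContinuousMap.coe_mk]
  rw [integral_apply_apply, Real.toNNReal_add hs.1 t.coe_nonneg, Real.toNNReal_coe]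

/-- The truncated distance to `C` is a test function whose integrals along the flow tend to zero; so
do their Cesàro means, and its integral against `η` vanishes. A general closed `C` is allowed
because the counterexample uses circles and points in place of `K`. -/
theorem measure_eq_one_of_eventually_mem {R : ContinuousSemigroup X} {ν η : ProbabilityMeasure X}
    (h : η ∈ R.omegaMeasure ν) {C : Set X} (hC : IsClosed C)
    (hν : ∀ᵐ x ∂(ν : Measure X), ∃ T : ℝ≥0, ∀ t, T ≤ t → R t x ∈ C) :
    (η : Measure X) C = 1 := by
  let := TopologicalSpace.upgradeIsCompletelyMetrizable X
  obtain ⟨x₀, T₀, hx₀⟩ := hν.exists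
  have hne : C.Nonempty := ⟨_, hx₀ T₀ le_rfl⟩
  obtain ⟨τ, hτ, hF⟩ := mem_omegaMeasure_iff.1 h
  let F : X →ᵇ ℝ := BoundedContinuousFunction.ofNormedAddCommGroup
    (fun x => min (Metric.infDist x C) 1)
    ((Metric.continuous_infDist_pt C).min continuous_const) 1 (fun x => by
      rw [Real.norm_of_nonneg (le_min Metric.infDist_nonneg zero_le_one)]
      exact min_le_right _ _)
  have hF0 : ∀ x, F x = 0 ↔ x ∈ C := by
    intro x
    rw [hC.mem_iff_infDist_zero hne]
    change min (Metric.infDist x C) 1 = 0 ↔ _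
    constructor
    · intro h
      rcases min_choice (Metric.infDist x C) 1 with h' | h' <;> rw [h'] at h
      · exact h
      · norm_num at h
    · intro h
      rw [h]; simp
  have hlim : Tendsto (fun s : ℝ => ∫ x, F (R s.toNNReal x) ∂(ν : Measure X)) atTop (𝓝 0) := by
    have := tendsto_integral_filter_of_dominated_convergence (μ := (ν : Measure X))
      (F := fun (s : ℝ) x => F (R s.toNNReal x)) (f := fun _ => 0) (l := atTop) (fun _ => ‖F‖)
      (Eventually.of_forall fun s =>
        (F.continuous.comp (R.continuous_map _)).measurable.aestronglyMeasurable)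
      (Eventually.of_forall fun s => Eventually.of_forall fun x => F.norm_coe_le_norm _)
      (integrable_const _) ?_
    · simpa using this
    · filter_upwards [hν] with x ⟨T, hT⟩
      refine tendsto_const_nhds.congr' ?_
      filter_upwards [eventually_ge_atTop (T : ℝ)] with s hs
      exact ((hF0 _).2 (hT _ (NNReal.le_toNNReal_of_coe_le hs))).symm
  have h1 := (tendsto_interval_average (R.continuous_integral_orbit ν F).measurable
    (fun s => R.abs_integral_orbit_le ν F s.toNNReal) hlim).comp hτ
  have h2 : ∫ x, F x ∂(η : Measure X) = 0 := tendsto_nhds_unique (hF F) h1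
  rw [integral_eq_zero_iff_of_nonneg
    (show 0 ≤ ⇑F from fun x => le_min Metric.infDist_nonneg zero_le_one) (F.integrable _)] at h2
  rw [← mem_ae_iff_prob_eq_one hC.measurableSet]
  filter_upwards [h2] with x hx
  exact (hF0 x).1 hx

theorem omegaMeasure_eq_singleton_of_invariant {R : ContinuousSemigroup X}
    {ν : ProbabilityMeasure X} (h : ∀ t, R.pushforward t ν = ν) : R.omegaMeasure ν = {ν} := by
  have : average R.pushforward ν = fun _ => ν := by
    funext r
    rcases le_or_gt r 0 with hr | hr
    · exact dif_neg hr.not_gt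
    · rw [average_of_pos _ _ hr]
      refine ProbabilityMeasure.ext_of_integral_eq fun F => ?_
      rw [integral_timeAverage]
      simp_rw [h]
      simp [hr.ne']
  ext η
  rw [omegaMeasure, mem_omegaBirkhoff_iff, this, mem_singleton_iff]
  constructor
  · intro hη
    -- A cluster point of a constant map is a specialization of its value, hence equal to it by
    -- separation.
    have : ClusterPt η (pure ν) := by simpa [MapClusterPt, Filter.map_const] using hη
    exact (specializes_iff_clusterPt.2 this).eq.symm
  · rintro rfl
    exact tendsto_const_nhds.mapClusterPt

end

end ContinuousSemigroup

/-! ### Convex combinations and compactness of probability measures -/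

namespace MeasureTheory.ProbabilityMeasure

section

variable {X : Type u} [MeasurableSpace X]

/-- The convex combination `a μ + b ν` of two probability measures. -/
noncomputable def convexCombo (a b : ℝ≥0) (h : a + b = 1) (μ ν : ProbabilityMeasure X) :
    ProbabilityMeasure X :=
  ⟨a • (μ : Measure X) + b • (ν : Measure X), ⟨by
    simp only [Measure.coe_add, Measure.coe_nnreal_smul_apply, Pi.add_apply, measure_univ, mul_one]
    exact_mod_cast h⟩⟩

theorem coe_convexCombo (a b : ℝ≥0) (h : a + b = 1) (μ ν : ProbabilityMeasure X) :
    (convexCombo a b h μ ν : Measure X) = a • (μ : Measure X) + b • (ν : Measure X) := rfl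

theorem toFiniteMeasure_convexCombo (a b : ℝ≥0) (h : a + b = 1) (μ ν : ProbabilityMeasure X) :
    (convexCombo a b h μ ν).toFiniteMeasure = a • μ.toFiniteMeasure + b • ν.toFiniteMeasure := by
  apply Subtype.ext
  rw [FiniteMeasure.val_eq_toMeasure, FiniteMeasure.val_eq_toMeasure, FiniteMeasure.toMeasure_add,
    FiniteMeasure.toMeasure_smul, FiniteMeasure.toMeasure_smul]
  rfl

theorem toFiniteMeasure_injective :
    Function.Injective (toFiniteMeasure : ProbabilityMeasure X → FiniteMeasure X) := fun _ _ h =>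
  toMeasure_injective (congrArg FiniteMeasure.toMeasure h)

theorem isConvexSet_iff {A : Set (ProbabilityMeasure X)} :
    IsConvexSet A ↔ ∀ μ ∈ A, ∀ ν ∈ A, ∀ (a b : ℝ≥0) (h : a + b = 1), convexCombo a b h μ ν ∈ A := by
  constructor
  · intro hA μ hμ ν hν a b h
    obtain ⟨ρ, hρ, he⟩ := hA (mem_image_of_mem _ hμ) (mem_image_of_mem _ hν) zero_le zero_le h
    rw [← toFiniteMeasure_convexCombo a b h] at he
    rwa [← toFiniteMeasure_injective he]
  · rintro hA _ ⟨μ, hμ, rfl⟩ _ ⟨ν, hν, rfl⟩ a b _ _ h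
    exact ⟨_, hA μ hμ ν hν a b h, toFiniteMeasure_convexCombo a b h μ ν⟩

end

section

variable {X : Type u} [TopologicalSpace X] [MeasurableSpace X] [OpensMeasurableSpace X]

theorem integral_convexCombo (a b : ℝ≥0) (h : a + b = 1) (μ ν : ProbabilityMeasure X)
    (F : X →ᵇ ℝ) : ∫ x, F x ∂(convexCombo a b h μ ν : Measure X)
      = a * ∫ x, F x ∂(μ : Measure X) + b * ∫ x, F x ∂(ν : Measure X) := by
  rw [coe_convexCombo, integral_add_measure ((F.integrable _).smul_measure_nnreal)
    ((F.integrable _).smul_measure_nnreal), integral_smul_nnreal_measure,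
    integral_smul_nnreal_measure]
  rfl

end

/-- The probability measures carried by a compact set form a compact set. -/
theorem isCompact_setOf_apply_eq_one {X : Type u} [TopologicalSpace X] [T2Space X]
    [MeasurableSpace X] [BorelSpace X] {K : Set X} (hK : IsCompact K) :
    IsCompact {μ : ProbabilityMeasure X | (μ : Measure X) K = 1} := by
  have hu : Tendsto (fun n : ℕ => ((n : ℝ≥0) + 1)⁻¹) atTop (𝓝 0) := by
    have := tendsto_one_div_add_atTop_nhds_zero_nat (𝕜 := ℝ≥0)
    simpa using this
  -- In the tightness criterion all compact sets are taken equal to `K`; bounds tending to zero then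
  -- force `Kᶜ` to be null.
  convert isCompact_setOfPred_probabilityMeasure_mass_eq_compl_isCompact_le hu (fun _ => hK)
    (Or.inr monotone_const) using 1
  ext μ
  simp only [mem_ofPred_eq]
  rw [← prob_compl_eq_zero_iff hK.measurableSet]
  constructor
  · intro h n
    rw [(null_iff_toMeasure_null μ Kᶜ).2 h]
    exact zero_le
  · intro h
    rw [← null_iff_toMeasure_null]
    exact le_antisymm (ge_of_tendsto' hu h) zero_le

end MeasureTheory.ProbabilityMeasure

/-! ### Limit sets and invariant measures -/

namespace ContinuousSemigroup

theorem diracProba_apply_eq_one {X : Type u} [TopologicalSpace X] [MeasurableSpace X]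
    [BorelSpace X] {K : Set X} (hK : IsClosed K) {y : X} (hy : y ∈ K) :
    (diracProba y : Measure X) K = 1 := by
  change Measure.dirac y K = 1
  rw [Measure.dirac_apply' _ hK.measurableSet, indicator_of_mem hy, Pi.one_apply]

variable {X : Type u} [TopologicalSpace X] [PolishSpace X] [MeasurableSpace X] [BorelSpace X]
  {R : ContinuousSemigroup X} {K : Set X}

theorem isClosed_omegaMeasure (R : ContinuousSemigroup X) (ν : ProbabilityMeasure X) :
    IsClosed (R.omegaMeasure ν) :=
  isClosed_iInter fun _ => isClosed_iInter fun _ => isClosed_closure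

theorem average_apply_eq_one (hK : IsClosed K) (hinv : R.IsForwardInvariant K)
    {ν : ProbabilityMeasure X} (hν : (ν : Measure X) K = 1) (r : ℝ) :
    (average R.pushforward ν r : Measure X) K = 1 := by
  rcases le_or_gt r 0 with hr | hr
  · rw [average, dif_neg hr.not_gt, hν]
  rw [average_of_pos _ _ hr, ← prob_compl_eq_zero_iff hK.measurableSet]
  have hm : Measurable fun τ : ℝ => (R.pushforward τ.toNNReal ν : Measure X) :=
    (measurable_curve _ (R.pushforward.continuous_orbit ν)).comp measurable_real_toNNReal
  refine (Measure.bind_apply hK.measurableSet.compl hm.aemeasurable).trans ?_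
  have h0 : ∀ τ : ℝ, (R.pushforward τ.toNNReal ν : Measure X) Kᶜ = 0 := by
    intro τ
    rw [prob_compl_eq_zero_iff hK.measurableSet, coe_pushforward,
      Measure.map_apply (R.continuous_map _).measurable hK.measurableSet]
    refine le_antisymm prob_le_one (hν.ge.trans (measure_mono fun x hx => ?_))
    exact hinv _ (mem_image_of_mem _ hx)
  simp only [h0, lintegral_zero]

/-- Forward invariance keeps all time averages in the compact set of measures carried by `K`, so
they have a cluster point. -/
theorem omegaMeasure_nonempty (hK : IsCompact K) (hinv : R.IsForwardInvariant K)
    {ν : ProbabilityMeasure X} (hν : (ν : Measure X) K = 1) : (R.omegaMeasure ν).Nonempty := by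
  obtain ⟨ρ, -, hρ⟩ := (ProbabilityMeasure.isCompact_setOf_apply_eq_one hK).exists_mapClusterPt
    (f := (atTop : Filter ℝ)) (u := average R.pushforward ν)
    (tendsto_principal.2 (Eventually.of_forall (average_apply_eq_one hK.isClosed hinv hν)))
  exact ⟨ρ, mem_omegaBirkhoff_iff.2 hρ⟩

theorem omegaMeasure_subset_invariantMeasures (hK : IsClosed K) (habs : R.IsAbsorbing K)
    (ν : ProbabilityMeasure X) : R.omegaMeasure ν ⊆ R.invariantMeasures K := fun _ hη =>
  ⟨measure_eq_one_of_eventually_mem hη hK (Eventually.of_forall habs),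
    pushforward_eq_of_mem_omegaMeasure hη⟩

/-- An invariant measure is its own limit, and limits are carried by `K`. -/
theorem mem_invariantMeasures_of_invariant (hK : IsClosed K) (habs : R.IsAbsorbing K)
    {ν : ProbabilityMeasure X} (h : ∀ t, R.pushforward t ν = ν) : ν ∈ R.invariantMeasures K :=
  omegaMeasure_subset_invariantMeasures hK habs ν
    (by rw [omegaMeasure_eq_singleton_of_invariant h]; rfl)

theorem measureLimits_eq_invariantMeasures (hK : IsClosed K) (habs : R.IsAbsorbing K) :
    R.measureLimits = R.invariantMeasures K := by
  refine Subset.antisymm (iUnion_subset (omegaMeasure_subset_invariantMeasures hK habs))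
    fun η hη => mem_iUnion.2 ⟨η, ?_⟩
  rw [omegaMeasure_eq_singleton_of_invariant hη.2]
  rfl

theorem isCompact_invariantMeasures (hK : IsCompact K) : IsCompact (R.invariantMeasures K) := by
  refine (ProbabilityMeasure.isCompact_setOf_apply_eq_one hK).inter_right
    (t := {η | ∀ t, R.pushforward t η = η}) ?_
  simp only [ofPred_forall]
  exact isClosed_iInter fun t => isClosed_eq (R.pushforward.continuous_map t) continuous_id

theorem isConvexSet_invariantMeasures (R : ContinuousSemigroup X) (K : Set X) :
    ProbabilityMeasure.IsConvexSet (R.invariantMeasures K) := by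
  rw [ProbabilityMeasure.isConvexSet_iff]
  intro μ hμ ν hν a b h
  constructor
  · rw [ProbabilityMeasure.coe_convexCombo]
    simp only [Measure.coe_add, Measure.coe_nnreal_smul_apply, Pi.add_apply, hμ.1, hν.1, mul_one]
    exact_mod_cast h
  · intro t
    refine ProbabilityMeasure.ext_of_integral_eq fun F => ?_
    have h1 := ProbabilityMeasure.integral_convexCombo a b h μ ν
      (F.compContinuous ⟨R t, R.continuous_map t⟩)
    simp only [BoundedContinuousFunction.compContinuous_apply, ContinuousMap.coe_mk] at h1
    rw [integral_pushforward, h1, ← integral_pushforward, ← integral_pushforward, hμ.2, hν.2,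
      ProbabilityMeasure.integral_convexCombo]

theorem isForwardInvariant_omegaMeasure (R : ContinuousSemigroup X) (ν : ProbabilityMeasure X) :
    R.pushforward.IsForwardInvariant (R.omegaMeasure ν) := by
  rintro t _ ⟨η, hη, rfl⟩
  rwa [pushforward_eq_of_mem_omegaMeasure hη]

theorem isCompact_omegaMeasure (hK : IsCompact K) (habs : R.IsAbsorbing K)
    (ν : ProbabilityMeasure X) : IsCompact (R.omegaMeasure ν) :=
  (isCompact_invariantMeasures hK).of_isClosed_subset (R.isClosed_omegaMeasure ν)
    (omegaMeasure_subset_invariantMeasures hK.isClosed habs ν)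

theorem isStatisticalAttractor_omegaMeasure (hK : IsCompact K) (hinv : R.IsForwardInvariant K)
    (habs : R.IsAbsorbing K) {ν : ProbabilityMeasure X} (hν : (ν : Measure X) K = 1) :
    IsStatisticalAttractor R.pushforward (R.omegaMeasure ν) where
  nonempty := omegaMeasure_nonempty hK hinv hν
  isCompact := isCompact_omegaMeasure hK habs ν
  forwardInvariant := R.isForwardInvariant_omegaMeasure ν
  attraction := ⟨ν, Subset.rfl⟩

/-- If `ω(ν)` is a singleton then the time averages of `ν` converge to its element. -/
theorem tendsto_average_of_omegaMeasure_eq_singleton (hK : IsCompact K)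
    (hinv : R.IsForwardInvariant K) {ν μ : ProbabilityMeasure X} (hν : (ν : Measure X) K = 1)
    (h : R.omegaMeasure ν = {μ}) : Tendsto (average R.pushforward ν) atTop (𝓝 μ) :=
  (ProbabilityMeasure.isCompact_setOf_apply_eq_one hK).tendsto_nhds_of_unique_mapClusterPt
    (Eventually.of_forall (average_apply_eq_one hK.isClosed hinv hν)) fun ρ _ hρ => by
      have : ρ ∈ R.omegaMeasure ν := mem_omegaBirkhoff_iff.2 hρ
      rwa [h] at this

theorem tendsto_integral_of_omegaMeasure_eq_singleton (hK : IsCompact K)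
    (hinv : R.IsForwardInvariant K) {μ : ProbabilityMeasure X} {y : X} (hy : y ∈ K)
    (h : R.omegaMeasure (diracProba y) = {μ}) (F : X →ᵇ ℝ) :
    Tendsto (fun r : ℝ => r⁻¹ * ∫ s in (0 : ℝ)..r, F (R s.toNNReal y)) atTop
      (𝓝 (∫ x, F x ∂(μ : Measure X))) := by
  have h1 := (ProbabilityMeasure.tendsto_iff_forall_integral_tendsto.1
    (tendsto_average_of_omegaMeasure_eq_singleton hK hinv
      (diracProba_apply_eq_one hK.isClosed hy) h)) F
  refine h1.congr' ?_
  filter_upwards [eventually_gt_atTop 0] with r hr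
  rw [average_of_pos _ _ hr, integral_timeAverage]
  congr 1
  refine intervalIntegral.integral_congr fun s _ => ?_
  simp only [integral_pushforward]
  exact integral_dirac (fun x => F (R s.toNNReal x)) y

end ContinuousSemigroup

/-! ### The maximal ergodic theorem -/

section MaximalErgodic

variable {X : Type u}

/-- `maximalSum T f n x` is the maximum of the Birkhoff sums of `f` at `x` of length at most `n`. -/
noncomputable def maximalSum (T : X → X) (f : X → ℝ) : ℕ → X → ℝ
  | 0 => 0
  | n + 1 => fun x => max 0 (f x + maximalSum T f n (T x))

theorem maximalSum_nonneg (T : X → X) (f : X → ℝ) (n : ℕ) (x : X) : 0 ≤ maximalSum T f n x := by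
  cases n with
  | zero => exact le_rfl
  | succ n => exact le_max_left _ _

theorem maximalSum_le_succ (T : X → X) (f : X → ℝ) (n : ℕ) :
    ∀ x, maximalSum T f n x ≤ maximalSum T f (n + 1) x := by
  induction n with
  | zero => exact fun x => maximalSum_nonneg T f 1 x
  | succ n ih => exact fun x => max_le_max_left 0 (by linarith [ih (T x)])

/-- **Maximal ergodic theorem**, in the case where almost every point has a positive Birkhoff
sum. -/
theorem integral_nonneg_of_ae_maximalSum_pos [MeasurableSpace X] {μ : Measure X}
    {T : X → X} (hT : MeasurePreserving T μ μ) {f : X → ℝ} (hfm : Measurable f)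
    (hf : Integrable f μ) (h : ∀ᵐ x ∂μ, ∃ n, 0 < maximalSum T f n x) : 0 ≤ ∫ x, f x ∂μ := by
  have hm : ∀ n, Measurable (maximalSum T f n) := by
    intro n
    induction n with
    | zero => exact measurable_const
    | succ n ih => exact measurable_const.max (hfm.add (ih.comp hT.measurable))
  have hi : ∀ n, Integrable (maximalSum T f n) μ := by
    intro n
    induction n with
    | zero => exact integrable_zero _ _ _
    | succ n ih => exact (integrable_zero X ℝ μ).sup (hf.add (hT.integrable_comp_of_integrable ih))
  let E : ℕ → Set X := fun n => {x | 0 < maximalSum T f n x}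
  have hE : ∀ n, MeasurableSet (E n) := fun n => measurableSet_lt measurable_const (hm n)
  have hmono : Monotone E := monotone_nat_of_le_succ fun n x hx =>
    lt_of_lt_of_le hx (maximalSum_le_succ T f n x)
  -- Writing `M` for the maximal sum, `M - M ∘ T` has integral zero by invariance. It is at most `f`
  -- on `E n`, by the recursion and monotonicity in `n`, and nonpositive off `E n`, where `M`
  -- vanishes.
  have hpos : ∀ n, 0 ≤ ∫ x in E n, f x ∂μ := by
    intro n
    have hiT : Integrable (fun x => maximalSum T f n (T x)) μ :=
      hT.integrable_comp_of_integrable (hi n)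
    have h0 : ∫ x, (maximalSum T f n x - maximalSum T f n (T x)) ∂μ = 0 := by
      rw [integral_sub (hi n) hiT, sub_eq_zero]
      conv_lhs => rw [← hT.map_eq]
      exact integral_map hT.measurable.aemeasurable (hm n).aestronglyMeasurable
    rw [← h0, ← integral_indicator (hE n)]
    refine integral_mono ((hi n).sub hiT)
      (hf.indicator (hE n)) fun x => ?_
    by_cases hx : x ∈ E n
    · rw [indicator_of_mem hx]
      cases n with
      | zero => exact absurd hx (lt_irrefl (0 : ℝ))
      | succ n =>
        have h1 : maximalSum T f (n + 1) x = f x + maximalSum T f n (T x) := by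
          change max _ _ = _
          refine max_eq_right (le_of_not_gt fun hlt => ?_)
          have : maximalSum T f (n + 1) x = 0 := max_eq_left hlt.le
          exact absurd hx (by simp [E, this])
        have h2 := maximalSum_le_succ T f n (T x)
        change maximalSum T f (n + 1) x - maximalSum T f (n + 1) (T x) ≤ _
        linarith
    · rw [indicator_of_notMem hx]
      have h1 : maximalSum T f n x ≤ 0 := not_lt.1 hx
      have h2 := maximalSum_nonneg T f n (T x)
      change maximalSum T f n x - maximalSum T f n (T x) ≤ _
      linarith
  have hlim := tendsto_setIntegral_of_monotone hE hmono hf.integrableOn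
  have huniv : (⋃ n, E n) =ᵐ[μ] univ := by
    rw [eventuallyEq_univ]
    filter_upwards [h] with x ⟨n, hn⟩
    exact mem_iUnion.2 ⟨n, hn⟩
  rw [setIntegral_congr_set huniv, setIntegral_univ] at hlim
  exact ge_of_tendsto' hlim hpos

end MaximalErgodic

/-! ### The pointwise ergodic theorem and the two descriptions of ergodicity -/

/-- Time averages converge along the reals as soon as they converge along the integers. -/
theorem tendsto_interval_average_of_nat {g : ℝ → ℝ} {c C : ℝ} (hg : Continuous g)
    (hC : ∀ s, |g s| ≤ C)
    (h : Tendsto (fun n : ℕ => (n : ℝ)⁻¹ * ∫ s in (0 : ℝ)..n, g s) atTop (𝓝 c)) :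
    Tendsto (fun r : ℝ => r⁻¹ * ∫ s in (0 : ℝ)..r, g s) atTop (𝓝 c) := by
  -- The average up to `r` is `⌊r⌋ / r` times the average up to `⌊r⌋`, plus a remainder of size at
  -- most `C / r`.
  have h1 := (tendsto_nat_floor_div_atTop (R := ℝ)).mul (h.comp tendsto_nat_floor_atTop)
  have h2 : Tendsto (fun r : ℝ => r⁻¹ * ∫ s in (⌊r⌋₊ : ℝ)..r, g s) atTop (𝓝 0) := by
    have h0 : Tendsto (fun r : ℝ => r⁻¹ * C) atTop (𝓝 0) := by
      simpa using tendsto_inv_atTop_zero.mul_const C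
    refine squeeze_zero_norm' ?_ h0
    filter_upwards [eventually_gt_atTop 0] with r hr
    rw [norm_mul, Real.norm_of_nonneg (inv_pos.2 hr).le]
    refine mul_le_mul_of_nonneg_left ?_ (inv_pos.2 hr).le
    refine (intervalIntegral.norm_integral_le_of_norm_le_const (C := C) fun s _ => hC s).trans ?_
    refine mul_le_of_le_one_right ((abs_nonneg _).trans (hC 0)) ?_
    rw [abs_of_nonneg (sub_nonneg.2 (Nat.floor_le hr.le))]
    linarith [Nat.lt_floor_add_one r]
  have h3 := h1.add h2
  rw [one_mul, add_zero] at h3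
  refine h3.congr' ?_
  filter_upwards [eventually_ge_atTop 1] with r hr
  have hf : (⌊r⌋₊ : ℝ) ≠ 0 := by
    exact_mod_cast (Nat.floor_pos.2 hr).ne'
  rw [← intervalIntegral.integral_add_adjacent_intervals
    (hg.intervalIntegrable 0 (⌊r⌋₊ : ℝ)) (hg.intervalIntegrable (⌊r⌋₊ : ℝ) r)]
  simp only [Function.comp_apply]
  field_simp

/-- A rational strictly between `c` and `q` leaves a gap that absorbs the vanishing difference. -/
theorem exists_rat_frequently_lt_of_tendsto_sub {u v : ℕ → ℝ} {c : ℝ}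
    (h : Tendsto (fun n => u n - v n) atTop (𝓝 0))
    (hu : ∃ q : ℚ, c < q ∧ ∃ᶠ n in atTop, (q : ℝ) < u n) :
    ∃ q : ℚ, c < q ∧ ∃ᶠ n in atTop, (q : ℝ) < v n := by
  obtain ⟨q, hq, hf⟩ := hu
  obtain ⟨p, hp, hpq⟩ := exists_rat_btwn hq
  refine ⟨p, hp, (hf.and_eventually (h.eventually_lt_const (sub_pos.2 hpq))).mono ?_⟩
  rintro n ⟨h1, h2⟩
  linarith

namespace MeasureTheory.ProbabilityMeasure

/-- Countably many bounded continuous functions separate the probability measures carried by a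
compact set. -/
theorem exists_seq_separating {X : Type u} [TopologicalSpace X] [PolishSpace X]
    [MeasurableSpace X] [BorelSpace X] {K : Set X} (hK : IsCompact K) :
    ∃ G : ℕ → X →ᵇ ℝ, ∀ μ ν : ProbabilityMeasure X, (μ : Measure X) K = 1 →
      (ν : Measure X) K = 1 →
      (∀ n, ∫ x, G n x ∂(μ : Measure X) = ∫ x, G n x ∂(ν : Measure X)) → μ = ν := by
  let := TopologicalSpace.upgradeIsCompletelyMetrizable X
  have : CompactSpace K := isCompact_iff_compactSpace.1 hK
  -- A dense sequence in the separable space `C(K, ℝ)`, extended to the whole space by Tietze's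
  -- theorem.
  choose G _ hG using fun n => BoundedContinuousFunction.exists_norm_eq_domRestrict_eq_of_closed
    (BoundedContinuousFunction.mkOfCompact (TopologicalSpace.denseSeq C(K, ℝ) n)) hK.isClosed
  refine ⟨G, fun μ ν hμ hν h => ext_of_integral_eq fun F => ?_⟩
  refine eq_of_forall_dist_le fun ε hε => ?_
  obtain ⟨n, hn⟩ := (TopologicalSpace.denseRange_denseSeq C(K, ℝ)).exists_dist_lt
    (F.toContinuousMap.restrict K) (half_pos hε)
  have hb : ∀ x ∈ K, ‖F x - G n x‖ ≤ ε / 2 := by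
    intro x hx
    have h1 := (ContinuousMap.dist_lt_iff (half_pos hε)).1 hn ⟨x, hx⟩
    have h2 : G n x = TopologicalSpace.denseSeq C(K, ℝ) n ⟨x, hx⟩ :=
      DFunLike.congr_fun (hG n) ⟨x, hx⟩
    rw [h2]
    exact h1.le
  have hint : ∀ ρ : ProbabilityMeasure X, (ρ : Measure X) K = 1 →
      dist (∫ x, F x ∂(ρ : Measure X)) (∫ x, G n x ∂(ρ : Measure X)) ≤ ε / 2 := by
    intro ρ hρ
    rw [dist_eq_norm, ← integral_sub (F.integrable _) ((G n).integrable _)]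
    refine (norm_integral_le_of_norm_le_const (C := ε / 2) ?_).trans (by simp)
    filter_upwards [(mem_ae_iff_prob_eq_one hK.measurableSet).2 hρ] with x hx using hb x hx
  calc _ ≤ _ := dist_triangle_right _ _ (∫ x, G n x ∂(μ : Measure X))
    _ ≤ ε / 2 + ε / 2 := add_le_add (hint μ hμ) (by rw [h n]; exact hint ν hν)
    _ = ε := add_halves ε

end MeasureTheory.ProbabilityMeasure

namespace ContinuousSemigroup

section

variable {X : Type u} [TopologicalSpace X]

theorem continuous_comp_orbit (R : ContinuousSemigroup X) (F : X →ᵇ ℝ) (y : X) :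
    Continuous fun s : ℝ => F (R s.toNNReal y) :=
  (F.continuous.comp (R.continuous_orbit y)).comp continuous_real_toNNReal

theorem integral_orbit_apply (R : ContinuousSemigroup X) (F : X →ᵇ ℝ) (y : X) (t : ℝ≥0) {r : ℝ}
    (hr : 0 ≤ r) : ∫ s in (0 : ℝ)..r, F (R s.toNNReal (R t y))
      = ∫ s in (0 : ℝ)..r, F (R (s + t).toNNReal y) := by
  refine intervalIntegral.integral_congr fun s hs => ?_
  rw [uIcc_of_le hr] at hs
  rw [← apply_add, Real.toNNReal_add hs.1 t.coe_nonneg, Real.toNNReal_coe]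

/-- This is the recursion that matches `maximalSum` for the time-one map. -/
theorem integral_orbit_one_add (R : ContinuousSemigroup X) (F : X →ᵇ ℝ) (y : X) (n : ℕ) :
    ∫ s in (0 : ℝ)..(n + 1 : ℕ), F (R s.toNNReal y)
      = (∫ s in (0 : ℝ)..1, F (R s.toNNReal y))
        + ∫ s in (0 : ℝ)..n, F (R s.toNNReal (R 1 y)) := by
  have hc := R.continuous_comp_orbit F y
  rw [R.integral_orbit_apply F y 1 n.cast_nonneg, NNReal.coe_one,
    intervalIntegral.integral_comp_add_right (fun s => F (R s.toNNReal y)), zero_add,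
    intervalIntegral.integral_add_adjacent_intervals (hc.intervalIntegrable _ _)
      (hc.intervalIntegrable _ _), Nat.cast_add_one]

theorem tendsto_average_orbit_sub (R : ContinuousSemigroup X) (F : X →ᵇ ℝ) (t : ℝ≥0) (y : X) :
    Tendsto (fun n : ℕ => ((n : ℝ)⁻¹ * ∫ s in (0 : ℝ)..n, F (R s.toNNReal (R t y)))
      - (n : ℝ)⁻¹ * ∫ s in (0 : ℝ)..n, F (R s.toNNReal y)) atTop (𝓝 0) := by
  have h := (tendsto_interval_average_shift_sub (R.continuous_comp_orbit F y)
    (fun s => F.norm_coe_le_norm _) (t : ℝ)).comp (tendsto_natCast_atTop_atTop (R := ℝ))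
  refine h.congr fun n => ?_
  rw [R.integral_orbit_apply F y t n.cast_nonneg]
  rfl

/-- The points at which the upper limit of the time averages of `F` along the integers exceeds
`c`. -/
def upperAverageSet (R : ContinuousSemigroup X) (F : X →ᵇ ℝ) (c : ℝ) : Set X :=
  {y | ∃ q : ℚ, c < q ∧ ∃ᶠ n : ℕ in atTop, (q : ℝ) < (n : ℝ)⁻¹ * ∫ s in (0 : ℝ)..n,
    F (R s.toNNReal y)}

/-- Shifting the starting point along its orbit does not change the upper limit. The invariance is
exact and holds for every time `t`, as the definition of ergodicity requires; the time-one map alone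
need not be ergodic. -/
theorem preimage_upperAverageSet (R : ContinuousSemigroup X) (F : X →ᵇ ℝ) (c : ℝ) (t : ℝ≥0) :
    R t ⁻¹' R.upperAverageSet F c = R.upperAverageSet F c := by
  ext y
  have h := R.tendsto_average_orbit_sub F t y
  refine ⟨exists_rat_frequently_lt_of_tendsto_sub h,
    exists_rat_frequently_lt_of_tendsto_sub ?_⟩
  simpa using h.neg

end

theorem measurePreserving_of_invariant {X : Type u} [TopologicalSpace X] [MeasurableSpace X]
    [BorelSpace X] {R : ContinuousSemigroup X} {μ : ProbabilityMeasure X}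
    (hμ : ∀ t, R.pushforward t μ = μ) (t : ℝ≥0) :
    MeasurePreserving (R t) (μ : Measure X) (μ : Measure X) :=
  ⟨(R.continuous_map t).measurable, congrArg ProbabilityMeasure.toMeasure (hμ t)⟩

variable {X : Type u} [TopologicalSpace X] [PolishSpace X] [MeasurableSpace X] [BorelSpace X]
  {R : ContinuousSemigroup X} {K : Set X}

theorem measurable_integral_orbit (R : ContinuousSemigroup X) (F : X →ᵇ ℝ) {r : ℝ} (hr : 0 ≤ r) :
    Measurable fun y => ∫ s in (0 : ℝ)..r, F (R s.toNNReal y) := by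
  simp_rw [intervalIntegral.integral_of_le hr]
  have : Measurable (Function.uncurry fun (y : X) (s : ℝ) => F (R s.toNNReal y)) :=
    F.continuous.measurable.comp (R.measurable_uncurry_toNNReal.comp measurable_swap)
  exact this.stronglyMeasurable.integral_prod_right.measurable

/-- By Fubini, since each time slice has the same integral over the invariant set `A`. -/
theorem setIntegral_integral_orbit {μ : ProbabilityMeasure X} (hμ : ∀ t, R.pushforward t μ = μ)
    {A : Set X} (hA : MeasurableSet A) (hinv : ∀ t, R t ⁻¹' A = A) (F : X →ᵇ ℝ) (r : ℝ) :
    ∫ y in A, (∫ s in (0 : ℝ)..r, F (R s.toNNReal y)) ∂(μ : Measure X)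
      = r * ∫ y in A, F y ∂(μ : Measure X) := by
  rw [← intervalIntegral_integral_swap]
  · have h : ∀ s : ℝ, ∫ y in A, F (R s.toNNReal y) ∂(μ : Measure X)
        = ∫ y in A, F y ∂(μ : Measure X) := by
      intro s
      have h1 := setIntegral_map (μ := (μ : Measure X)) (f := F) hA
        F.continuous.measurable.aestronglyMeasurable
        (R.continuous_map s.toNNReal).measurable.aemeasurable
      rw [hinv, ← coe_pushforward, hμ] at h1
      exact h1.symm
    simp [h]
  · have hm : Measurable (Function.uncurry fun (s : ℝ) (y : X) => F (R s.toNNReal y)) :=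
      F.continuous.measurable.comp R.measurable_uncurry_toNNReal
    have : IsFiniteMeasure ((volume : Measure ℝ).restrict (uIoc 0 r)) := ⟨by simp [uIoc]⟩
    exact Integrable.of_bound hm.aestronglyMeasurable ‖F‖
      (Eventually.of_forall fun p => F.norm_coe_le_norm _)

theorem isErgodicMeasure_of_mem_ergodicSet (hK : IsCompact K) (hKinv : R.IsForwardInvariant K)
    (habs : R.IsAbsorbing K) {μ : ProbabilityMeasure X} (hμ : μ ∈ R.ergodicSet) :
    R.IsErgodicMeasure μ := by
  have hmem : μ ∈ R.invariantMeasures K := by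
    obtain ⟨y, hy⟩ := Eventually.exists (show ∀ᵐ y ∂(μ : Measure X), _ from hμ)
    exact omegaMeasure_subset_invariantMeasures hK.isClosed habs (diracProba y) (by rw [hy]; rfl)
  refine ⟨hmem.2, fun A hA hinv => ?_⟩
  -- Over `A`, the time averages have constant integral `∫_A F dμ`, while they converge almost
  -- everywhere to the constant `∫ F dμ`.
  have key : ∀ F : X →ᵇ ℝ, ∫ x in A, F x ∂(μ : Measure X)
      = (μ : Measure X).real A * ∫ x, F x ∂(μ : Measure X) := by
    intro F
    have h1 : Tendsto (fun n : ℕ => ∫ y in A, ((n : ℝ)⁻¹ * ∫ s in (0 : ℝ)..n, F (R s.toNNReal y))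
        ∂(μ : Measure X)) atTop (𝓝 (∫ _y in A, ∫ x, F x ∂(μ : Measure X) ∂(μ : Measure X))) := by
      refine tendsto_integral_of_dominated_convergence (fun _ => ‖F‖) (fun n => ?_)
        (integrable_const _) (fun n => ?_) ?_
      · exact ((R.measurable_integral_orbit F n.cast_nonneg).const_mul _).aestronglyMeasurable
      · refine Eventually.of_forall fun y => ?_
        have := intervalIntegral.norm_integral_le_of_norm_le_const (a := 0) (b := n)
          (f := fun s : ℝ => F (R s.toNNReal y)) (C := ‖F‖) fun s _ => F.norm_coe_le_norm _
        rw [sub_zero, Nat.abs_cast] at this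
        rw [norm_mul, norm_inv, RCLike.norm_natCast]
        rcases n.eq_zero_or_pos with rfl | hn
        · simp
        · rw [inv_mul_le_iff₀ (by exact_mod_cast hn), mul_comm]
          exact this
      · refine ae_restrict_of_ae ?_
        filter_upwards [hμ, (mem_ae_iff_prob_eq_one hK.measurableSet).2 hmem.1] with y hy hyK
        exact (tendsto_integral_of_omegaMeasure_eq_singleton hK hKinv hyK hy F).comp
          tendsto_natCast_atTop_atTop
    rw [setIntegral_const, smul_eq_mul] at h1
    refine tendsto_nhds_unique (tendsto_const_nhds.congr' ?_) h1
    filter_upwards [eventually_gt_atTop 0] with n hn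
    rw [integral_const_mul, setIntegral_integral_orbit hmem.2 hA hinv, inv_mul_cancel_left₀]
    exact_mod_cast hn.ne'
  have hmeas : (μ : Measure X).restrict A = (μ A) • (μ : Measure X) := by
    refine ext_of_forall_integral_eq_of_IsFiniteMeasure fun F => ?_
    rw [key F, integral_smul_nnreal_measure]
    rfl
  -- Evaluation at `A` itself yields `μ(A) = μ(A)²`.
  have hA2 := congrArg (fun m : Measure X => m A) hmeas
  simp only [Measure.restrict_apply_self, Measure.coe_nnreal_smul_apply] at hA2
  rw [← ProbabilityMeasure.ennreal_coeFn_eq_coeFn_toMeasure] at hA2 ⊢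
  norm_cast at hA2 ⊢
  rcases eq_or_ne (μ A) 0 with h0 | h0
  · exact Or.inl h0
  · exact Or.inr (mul_left_cancel₀ h0 (by rw [mul_one]; exact hA2.symm))

theorem measurableSet_upperAverageSet (R : ContinuousSemigroup X) (F : X →ᵇ ℝ) (c : ℝ) :
    MeasurableSet (R.upperAverageSet F c) := by
  have : R.upperAverageSet F c = ⋃ (q : ℚ) (_ : c < q), limsup (fun n : ℕ =>
      {y | (q : ℝ) < (n : ℝ)⁻¹ * ∫ s in (0 : ℝ)..n, F (R s.toNNReal y)}) atTop := by
    ext y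
    simp [upperAverageSet, mem_limsup_iff_frequently_mem]
  rw [this]
  exact MeasurableSet.iUnion fun q => MeasurableSet.iUnion fun _ =>
    MeasurableSet.measurableSet_limsup fun n => measurableSet_lt measurable_const
      ((R.measurable_integral_orbit F n.cast_nonneg).const_mul _)

/-- By ergodicity the only alternative is full measure. Then almost every point has a positive
Birkhoff sum of `f`, the unit-time integral of `F` minus `c`, and the maximal ergodic theorem gives
`∫ F dμ ≥ c`. -/
theorem measure_upperAverageSet_eq_zero {μ : ProbabilityMeasure X} (hμ : R.IsErgodicMeasure μ)
    (F : X →ᵇ ℝ) {c : ℝ} (hc : ∫ x, F x ∂(μ : Measure X) < c) :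
    (μ : Measure X) (R.upperAverageSet F c) = 0 := by
  refine (hμ.2 _ (R.measurableSet_upperAverageSet F c)
    (R.preimage_upperAverageSet F c)).resolve_right fun h1 => ?_
  let f : X → ℝ := fun y => (∫ s in (0 : ℝ)..1, F (R s.toNNReal y)) - c
  have hfm : Measurable f := (R.measurable_integral_orbit F zero_le_one).sub_const c
  have hI : Integrable (fun y => ∫ s in (0 : ℝ)..1, F (R s.toNNReal y)) (μ : Measure X) := by
    refine Integrable.of_bound (R.measurable_integral_orbit F zero_le_one).aestronglyMeasurable
      ‖F‖ (Eventually.of_forall fun y => ?_)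
    have := intervalIntegral.norm_integral_le_of_norm_le_const (a := 0) (b := 1)
      (f := fun s : ℝ => F (R s.toNNReal y)) (C := ‖F‖) fun s _ => F.norm_coe_le_norm _
    simpa using this
  have hsum : ∀ (n : ℕ) (y : X),
      (∫ s in (0 : ℝ)..n, F (R s.toNNReal y)) - n * c ≤ maximalSum (R 1) f n y := by
    intro n
    induction n with
    | zero => intro y; simp [maximalSum]
    | succ n ih =>
      intro y
      refine le_trans ?_ (le_max_right _ _)
      rw [R.integral_orbit_one_add F y n]
      have := ih (R 1 y)
      push_cast
      simp only [f]
      linarith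
  have hpos : 0 ≤ ∫ y, f y ∂(μ : Measure X) := by
    refine integral_nonneg_of_ae_maximalSum_pos (measurePreserving_of_invariant hμ.1 1) hfm
      (hI.sub (integrable_const c)) ?_
    filter_upwards [(mem_ae_iff_prob_eq_one (R.measurableSet_upperAverageSet F c)).2 h1]
      with y ⟨q, hq, hf⟩
    obtain ⟨n, hn, hn0⟩ := (hf.and_eventually (eventually_gt_atTop 0)).exists
    refine ⟨n, lt_of_lt_of_le ?_ (hsum n y)⟩
    have hn0' : (0 : ℝ) < n := by exact_mod_cast hn0
    have h2 := hq.trans hn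
    rw [inv_mul_eq_div, lt_div_iff₀ hn0'] at h2
    linarith
  have h2 := setIntegral_integral_orbit hμ.1 MeasurableSet.univ (fun _ => preimage_univ) F 1
  rw [setIntegral_univ, setIntegral_univ, one_mul] at h2
  rw [integral_sub hI (integrable_const c), h2] at hpos
  simp at hpos
  linarith

/-- **Pointwise ergodic theorem** for bounded continuous functions and ergodic measures. -/
theorem ae_tendsto_average_orbit {μ : ProbabilityMeasure X} (hμ : R.IsErgodicMeasure μ)
    (F : X →ᵇ ℝ) : ∀ᵐ y ∂(μ : Measure X),
      Tendsto (fun r : ℝ => r⁻¹ * ∫ s in (0 : ℝ)..r, F (R s.toNNReal y)) atTop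
        (𝓝 (∫ x, F x ∂(μ : Measure X))) := by
  -- The upper bound for `F` and for `-F` controls both the upper and the lower limit; rational
  -- thresholds leave a single null set.
  have hupper : ∀ G : X →ᵇ ℝ, ∀ᵐ y ∂(μ : Measure X), ∀ b > ∫ x, G x ∂(μ : Measure X),
      ∀ᶠ n : ℕ in atTop, (n : ℝ)⁻¹ * ∫ s in (0 : ℝ)..n, G (R s.toNNReal y) < b := by
    intro G
    have h : ∀ᵐ y ∂(μ : Measure X), ∀ c : ℚ, ∫ x, G x ∂(μ : Measure X) < c →
        y ∉ R.upperAverageSet G c :=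
      ae_all_iff.2 fun c => by
        by_cases hc : ∫ x, G x ∂(μ : Measure X) < c
        · filter_upwards [measure_eq_zero_iff_ae_notMem.1
            (measure_upperAverageSet_eq_zero hμ G hc)] with y hy _ using hy
        · exact Eventually.of_forall fun y h => absurd h hc
    filter_upwards [h] with y hy b hb
    obtain ⟨p, hp1, hp2⟩ := exists_rat_btwn hb
    obtain ⟨q, hq1, hq2⟩ := exists_rat_btwn hp2
    by_contra hcon
    refine hy p hp1 ⟨q, hq1, (Filter.not_eventually.1 hcon).mono fun n hn => ?_⟩
    exact hq2.trans_le (not_lt.1 hn)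
  filter_upwards [hupper F, hupper (-F)] with y h1 h2
  refine tendsto_interval_average_of_nat (R.continuous_comp_orbit F y)
    (fun s => F.norm_coe_le_norm _) (tendsto_order.2 ⟨fun a ha => ?_, fun b hb => h1 b hb⟩)
  have h3 := h2 (-a) (by
    simp only [BoundedContinuousFunction.coe_neg, Pi.neg_apply, integral_neg]
    exact neg_lt_neg ha)
  filter_upwards [h3] with n hn
  simp only [BoundedContinuousFunction.coe_neg, Pi.neg_apply, intervalIntegral.integral_neg,
    mul_neg] at hn
  exact neg_lt_neg_iff.1 hn

/-- Off one null set the averages of all separating functions converge to their `μ`-integrals. Every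
element of `ω(δ_y)` is carried by `K` and has the same integrals, hence equals `μ`. -/
theorem mem_ergodicSet_of_isErgodicMeasure (hK : IsCompact K) (hKinv : R.IsForwardInvariant K)
    (habs : R.IsAbsorbing K) {μ : ProbabilityMeasure X} (hμ : R.IsErgodicMeasure μ) :
    μ ∈ R.ergodicSet := by
  have hμK := (mem_invariantMeasures_of_invariant hK.isClosed habs hμ.1).1
  obtain ⟨G, hG⟩ := ProbabilityMeasure.exists_seq_separating hK
  have h : ∀ᵐ y ∂(μ : Measure X), ∀ n, Tendsto (fun r : ℝ => r⁻¹ * ∫ s in (0 : ℝ)..r,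
      G n (R s.toNNReal y)) atTop (𝓝 (∫ x, G n x ∂(μ : Measure X))) :=
    ae_all_iff.2 fun n => ae_tendsto_average_orbit hμ (G n)
  change ∀ᵐ y ∂(μ : Measure X), _
  filter_upwards [h, (mem_ae_iff_prob_eq_one hK.measurableSet).2 hμK] with y hy hyK
  refine Nonempty.subset_singleton_iff (omegaMeasure_nonempty hK hKinv
    (diracProba_apply_eq_one hK.isClosed hyK)) |>.1 fun η hη => ?_
  refine hG η μ (omegaMeasure_subset_invariantMeasures hK.isClosed habs _ hη).1 hμK fun n => ?_
  rw [omegaMeasure_dirac] at hη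
  obtain ⟨τ, hτ, hlim⟩ := hη
  exact tendsto_nhds_unique (hlim (G n)) ((hy n).comp hτ)

theorem ergodicSet_eq (hK : IsCompact K) (hKinv : R.IsForwardInvariant K)
    (habs : R.IsAbsorbing K) : R.ergodicSet = {μ | R.IsErgodicMeasure μ} :=
  Subset.antisymm (fun _ => isErgodicMeasure_of_mem_ergodicSet hK hKinv habs)
    (fun _ => mem_ergodicSet_of_isErgodicMeasure hK hKinv habs)

theorem ergodicSet_subset_pointLimits (R : ContinuousSemigroup X) :
    R.ergodicSet ⊆ R.pointLimits := by
  intro μ hμ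
  obtain ⟨y, hy⟩ := Eventually.exists (show ∀ᵐ y ∂(μ : Measure X), _ from hμ)
  exact mem_iUnion.2 ⟨y, by rw [hy]; rfl⟩

theorem pointLimits_subset_measureLimits (R : ContinuousSemigroup X) :
    R.pointLimits ⊆ R.measureLimits :=
  iUnion_subset fun y => subset_iUnion R.omegaMeasure (diracProba y)

end ContinuousSemigroup

/-! ### Krein–Milman for probability measures -/

namespace MeasureTheory.ProbabilityMeasure

theorem isConvexSet_convexHull {X : Type u} [MeasurableSpace X]
    (A : Set (ProbabilityMeasure X)) :
    IsConvexSet (toFiniteMeasure ⁻¹' convexHull ℝ≥0 (toFiniteMeasure '' A)) := by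
  rw [isConvexSet_iff]
  intro μ hμ ν hν a b h
  rw [mem_preimage, toFiniteMeasure_convexCombo]
  exact convex_convexHull ℝ≥0 _ hμ hν zero_le zero_le h

variable {X : Type u} [TopologicalSpace X] [MeasurableSpace X] [OpensMeasurableSpace X]

/-- A probability measure as a functional on bounded continuous functions. -/
noncomputable def integralFunctional (μ : ProbabilityMeasure X) : (X →ᵇ ℝ) → ℝ :=
  fun F => ∫ x, F x ∂(μ : Measure X)

theorem continuous_integralFunctional :
    Continuous (integralFunctional : ProbabilityMeasure X → (X →ᵇ ℝ) → ℝ) :=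
  _root_.continuous_pi fun F => continuous_integral_boundedContinuousFunction F

/-- Closures of sets of measures can thus be computed in a real locally convex space. -/
theorem isInducing_integralFunctional :
    IsInducing (integralFunctional : ProbabilityMeasure X → (X →ᵇ ℝ) → ℝ) := by
  refine isInducing_iff_nhds.2 fun μ => le_antisymm
    (continuous_integralFunctional.tendsto μ).le_comap ?_
  refine tendsto_id'.1 ((tendsto_iff_forall_integral_tendsto
    (μs := fun ν : ProbabilityMeasure X => ν)).2 fun F => ?_)
  exact ((continuous_apply F).tendsto (integralFunctional μ)).comp tendsto_comap

theorem integralFunctional_convexCombo (a b : ℝ≥0) (h : a + b = 1) (μ ν : ProbabilityMeasure X) :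
    integralFunctional (convexCombo a b h μ ν)
      = (a : ℝ) • integralFunctional μ + (b : ℝ) • integralFunctional ν :=
  funext fun F => integral_convexCombo a b h μ ν F

theorem convex_image_integralFunctional {A : Set (ProbabilityMeasure X)} (hA : IsConvexSet A) :
    Convex ℝ (integralFunctional '' A) := by
  rintro _ ⟨μ, hμ, rfl⟩ _ ⟨ν, hν, rfl⟩ a b ha hb hab
  lift a to ℝ≥0 using ha
  lift b to ℝ≥0 using hb
  have h : a + b = 1 := by exact_mod_cast hab
  exact ⟨_, isConvexSet_iff.1 hA μ hμ ν hν a b h, integralFunctional_convexCombo a b h μ ν⟩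

theorem closedHull_subset {A B : Set (ProbabilityMeasure X)} (hAB : A ⊆ B) (hB : IsClosed B)
    (hconv : IsConvexSet B) : closedHull A ⊆ B := by
  refine closure_minimal (fun μ hμ => ?_) hB
  obtain ⟨ν, hν, he⟩ := convexHull_min (image_mono hAB) hconv hμ
  rwa [← toFiniteMeasure_injective he]

/-- **Krein–Milman theorem** for compact convex sets of probability measures. -/
theorem subset_closedHull_of_extremePoints_subset {A B : Set (ProbabilityMeasure X)}
    (hB : IsCompact B) (hconv : IsConvexSet B)
    (hext : extremePoints ℝ (integralFunctional '' B) ⊆ integralFunctional '' A) :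
    B ⊆ closedHull A := by
  intro μ hμ
  have h1 : integralFunctional μ ∈ closure (convexHull ℝ
      (extremePoints ℝ (integralFunctional '' B))) := by
    rw [closure_convexHull_extremePoints (hB.image continuous_integralFunctional)
      (convex_image_integralFunctional hconv)]
    exact mem_image_of_mem _ hμ
  rw [closedHull, isInducing_integralFunctional.closure_eq_preimage_closure_image, mem_preimage]
  refine closure_mono (convexHull_min (hext.trans (image_mono fun ν hν => ?_))
    (convex_image_integralFunctional (isConvexSet_convexHull A))) h1
  exact subset_convexHull ℝ≥0 _ (mem_image_of_mem _ hν)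

end MeasureTheory.ProbabilityMeasure

/-! ### Extreme invariant measures are ergodic -/

namespace ContinuousSemigroup

variable {X : Type u} [TopologicalSpace X] [PolishSpace X] [MeasurableSpace X] [BorelSpace X]
  {R : ContinuousSemigroup X} {K : Set X}

open ProbabilityTheory in
theorem invariant_cond {X : Type u} [TopologicalSpace X] [MeasurableSpace X] [BorelSpace X]
    {R : ContinuousSemigroup X} {μ ρ : ProbabilityMeasure X} (hμ : ∀ t, R.pushforward t μ = μ)
    {A : Set X} (hA : MeasurableSet A) (hinv : ∀ t, R t ⁻¹' A = A)
    (hρ : (ρ : Measure X) = (μ : Measure X)[|A]) (t : ℝ≥0) : R.pushforward t ρ = ρ := by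
  refine ProbabilityMeasure.toMeasure_injective ?_
  have hT := measurePreserving_of_invariant hμ t
  have h := (hT.restrict_preimage hA).map_eq
  rw [hinv] at h
  rw [coe_pushforward, hρ, ProbabilityTheory.cond, Measure.map_smul, h]

open ProbabilityTheory in
-- If `0 < μ(A) < 1` for an invariant `A`, then `μ` is a proper convex combination of its
-- conditionings on `A` and `Aᶜ`, both invariant. Extremality makes the first equal to `μ`, so `μ(A)
-- = 1`, a contradiction.
theorem isErgodicMeasure_of_mem_extremePoints (hK : IsClosed K) (habs : R.IsAbsorbing K)
    {μ : ProbabilityMeasure X} (hμ : ∀ t, R.pushforward t μ = μ)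
    (hext : μ.integralFunctional ∈
      extremePoints ℝ (ProbabilityMeasure.integralFunctional '' R.invariantMeasures K)) :
    R.IsErgodicMeasure μ := by
  refine ⟨hμ, fun A hA hinv => ?_⟩
  by_contra! hcon
  have hAc : (μ : Measure X) Aᶜ ≠ 0 := fun h => hcon.2 ((prob_compl_eq_zero_iff hA).1 h)
  have hinvc : ∀ t, R t ⁻¹' Aᶜ = Aᶜ := fun t => by rw [preimage_compl, hinv]
  let μ₁ : ProbabilityMeasure X := ⟨(μ : Measure X)[|A], cond_isProbabilityMeasure hcon.1⟩
  let μ₂ : ProbabilityMeasure X := ⟨(μ : Measure X)[|Aᶜ], cond_isProbabilityMeasure hAc⟩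
  have h1 : μ₁ ∈ R.invariantMeasures K :=
    mem_invariantMeasures_of_invariant hK habs (invariant_cond hμ hA hinv rfl)
  have h2 : μ₂ ∈ R.invariantMeasures K :=
    mem_invariantMeasures_of_invariant hK habs (invariant_cond hμ hA.compl hinvc rfl)
  have hsum : μ A + μ Aᶜ = 1 := by
    have := prob_add_prob_compl (μ := (μ : Measure X)) hA
    rw [← ProbabilityMeasure.ennreal_coeFn_eq_coeFn_toMeasure,
      ← ProbabilityMeasure.ennreal_coeFn_eq_coeFn_toMeasure] at this
    exact_mod_cast this
  have hcombo : ProbabilityMeasure.convexCombo (μ A) (μ Aᶜ) hsum μ₁ μ₂ = μ := by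
    refine ProbabilityMeasure.toMeasure_injective (Measure.ext fun B hB => ?_)
    have h := cond_add_cond_compl_eq (μ := (μ : Measure X)) (t := B) hA
    rw [ProbabilityMeasure.coe_convexCombo]
    simp only [Measure.coe_add, Measure.coe_nnreal_smul_apply, Pi.add_apply]
    rw [ProbabilityMeasure.ennreal_coeFn_eq_coeFn_toMeasure,
      ProbabilityMeasure.ennreal_coeFn_eq_coeFn_toMeasure]
    conv_rhs => rw [← h]
    rw [mul_comm, mul_comm (_ : ℝ≥0∞) ((μ₂ : Measure X) B)]
    rfl
  have hpos : ∀ {B : Set X}, (μ : Measure X) B ≠ 0 → (0 : ℝ) < μ B := fun {B} hB => by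
    rw [NNReal.coe_pos, pos_iff_ne_zero, ne_eq, ProbabilityMeasure.null_iff_toMeasure_null]
    exact hB
  have heq : μ₁.integralFunctional = μ.integralFunctional := by
    refine hext.2 (mem_image_of_mem _ h1) (mem_image_of_mem _ h2)
      ⟨μ A, μ Aᶜ, hpos hcon.1, hpos hAc, by exact_mod_cast hsum, ?_⟩
    rw [← ProbabilityMeasure.integralFunctional_convexCombo _ _ hsum, hcombo]
  have h3 : μ₁ = μ := ProbabilityMeasure.ext_of_integral_eq fun F => congrFun heq F
  apply hcon.2
  rw [← h3]
  exact cond_apply_self hcon.1 (measure_ne_top _ _)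

theorem invariantMeasures_eq_closedHull (hK : IsCompact K) (hKinv : R.IsForwardInvariant K)
    (habs : R.IsAbsorbing K) :
    R.invariantMeasures K = ProbabilityMeasure.closedHull R.ergodicSet := by
  refine Subset.antisymm (ProbabilityMeasure.subset_closedHull_of_extremePoints_subset
    (isCompact_invariantMeasures hK) (R.isConvexSet_invariantMeasures K) ?_)
    (ProbabilityMeasure.closedHull_subset ?_ (isCompact_invariantMeasures hK).isClosed
      (R.isConvexSet_invariantMeasures K))
  · intro φ hφ
    obtain ⟨μ, hμ, rfl⟩ := hφ.1
    exact mem_image_of_mem _ (mem_ergodicSet_of_isErgodicMeasure hK hKinv habs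
      (isErgodicMeasure_of_mem_extremePoints hK.isClosed habs hμ.2 hφ))
  · rw [← measureLimits_eq_invariantMeasures hK.isClosed habs]
    exact R.ergodicSet_subset_pointLimits.trans R.pointLimits_subset_measureLimits

end ContinuousSemigroup

/-! ### A flow whose point limits are neither closed nor convex -/

section SpiralFlow

open ContinuousSemigroup

/-- The flow on `ℂ` that rotates the circle of radius `ρ ≤ 1` with angular speed `1 - ρ` and
contracts the complement of the unit disk radially onto the unit circle, in finite time along each
orbit. -/
noncomputable def spiralMap (t : ℝ≥0) (z : ℂ) : ℂ :=
  ((max (max 1 ‖z‖)⁻¹ (Real.exp (-t)) : ℝ) : ℂ)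
    * Complex.exp ((t * max 0 (1 - ‖z‖) : ℝ) * Complex.I) * z

theorem spiralMap_of_norm_le_one {z : ℂ} (hz : ‖z‖ ≤ 1) (t : ℝ≥0) :
    spiralMap t z = Complex.exp ((t * (1 - ‖z‖) : ℝ) * Complex.I) * z := by
  rw [spiralMap, max_eq_left hz, max_eq_right (sub_nonneg.2 hz), inv_one,
    max_eq_left (Real.exp_le_one_iff.2 (by simp)), Complex.ofReal_one, one_mul]

theorem spiralMap_of_one_le_norm {z : ℂ} (hz : 1 ≤ ‖z‖) (t : ℝ≥0) :
    spiralMap t z = ((max ‖z‖⁻¹ (Real.exp (-t)) : ℝ) : ℂ) * z := by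
  rw [spiralMap, max_eq_right hz, max_eq_left (sub_nonpos.2 hz)]
  simp

theorem norm_spiralMap_of_norm_le_one {z : ℂ} (hz : ‖z‖ ≤ 1) (t : ℝ≥0) :
    ‖spiralMap t z‖ = ‖z‖ := by
  rw [spiralMap_of_norm_le_one hz, norm_mul, Complex.norm_exp_ofReal_mul_I, one_mul]

theorem norm_spiralMap_of_one_le_norm {z : ℂ} (hz : 1 ≤ ‖z‖) (t : ℝ≥0) :
    ‖spiralMap t z‖ = max 1 (Real.exp (-t) * ‖z‖) := by
  have h0 : 0 < ‖z‖ := one_pos.trans_le hz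
  rw [spiralMap_of_one_le_norm hz, norm_mul, Complex.norm_real,
    Real.norm_of_nonneg (le_max_of_le_right (Real.exp_pos _).le), max_mul_of_nonneg _ _ h0.le,
    inv_mul_cancel₀ h0.ne']

theorem continuous_spiralMap : Continuous (Function.uncurry spiralMap) := by
  have h : ∀ p : ℝ≥0 × ℂ, max 1 ‖p.2‖ ≠ 0 := fun p => (lt_max_of_lt_left one_pos).ne'
  unfold spiralMap Function.uncurry
  fun_prop (disch := assumption)

theorem spiralMap_add (s t : ℝ≥0) (z : ℂ) : spiralMap (s + t) z = spiralMap s (spiralMap t z) := by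
  rcases le_total ‖z‖ 1 with hz | hz
  · have h := norm_spiralMap_of_norm_le_one hz t
    rw [spiralMap_of_norm_le_one (h.trans_le hz), h, spiralMap_of_norm_le_one hz,
      spiralMap_of_norm_le_one hz, ← mul_assoc, ← Complex.exp_add]
    congr 2
    push_cast
    ring
  · have h := norm_spiralMap_of_one_le_norm hz t
    have h0 : 0 < ‖z‖ := one_pos.trans_le hz
    have h1 : 1 ≤ ‖spiralMap t z‖ := h ▸ le_max_left _ _
    have hN : ‖spiralMap t z‖ = max ‖z‖⁻¹ (Real.exp (-t)) * ‖z‖ := by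
      rw [h, max_mul_of_nonneg _ _ h0.le, inv_mul_cancel₀ h0.ne']
    rw [spiralMap_of_one_le_norm h1, hN, spiralMap_of_one_le_norm hz,
      spiralMap_of_one_le_norm hz, ← mul_assoc, ← Complex.ofReal_mul]
    congr 2
    have hc : 0 < max ‖z‖⁻¹ (Real.exp (-t)) := lt_max_of_lt_right (Real.exp_pos _)
    have he : Real.exp (-s) * ‖z‖⁻¹ ≤ ‖z‖⁻¹ :=
      mul_le_of_le_one_left (inv_pos.2 h0).le (Real.exp_le_one_iff.2 (by simp))
    rw [max_mul_of_nonneg _ _ hc.le, mul_inv_rev, inv_mul_cancel_right₀ hc.ne',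
      mul_max_of_nonneg _ _ (Real.exp_pos _).le, ← max_assoc, max_eq_left he, ← Real.exp_add]
    congr 2
    push_cast
    ring

/-- The flow `spiralMap` as a continuous semigroup. -/
noncomputable def spiral : ContinuousSemigroup ℂ where
  toFun := spiralMap
  map_zero' := by
    funext z
    rcases le_total ‖z‖ 1 with hz | hz
    · rw [spiralMap_of_norm_le_one hz]; simp
    · rw [spiralMap_of_one_le_norm hz]
      simp [inv_le_one_of_one_le₀ hz]
  map_add' s t := funext (spiralMap_add s t)
  continuous_map t := continuous_spiralMap.uncurry_left t
  continuous_orbit z := continuous_spiralMap.uncurry_right z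

theorem spiral_apply (t : ℝ≥0) (z : ℂ) : spiral t z = spiralMap t z := rfl

theorem spiral_apply_of_norm_eq_one {z : ℂ} (hz : ‖z‖ = 1) (t : ℝ≥0) : spiral t z = z := by
  rw [spiral_apply, spiralMap_of_norm_le_one hz.le]
  simp [hz]

theorem exists_spiral_apply_eq {z : ℂ} (hz : 1 ≤ ‖z‖) :
    ∃ T : ℝ≥0, ∀ t, T ≤ t → spiral t z = (‖z‖⁻¹ : ℝ) * z := by
  -- At time `log ‖z‖` the contracted radius `exp (-t) * ‖z‖` reaches `1`.
  refine ⟨(Real.log ‖z‖).toNNReal, fun t ht => ?_⟩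
  have h0 : 0 < ‖z‖ := one_pos.trans_le hz
  rw [spiral_apply, spiralMap_of_one_le_norm hz, max_eq_left]
  rw [Real.exp_neg]
  exact inv_anti₀ h0 ((Real.log_le_iff_le_exp h0).1 (Real.toNNReal_le_iff_le_coe.1 ht))

theorem norm_inv_norm_mul {z : ℂ} (hz : 1 ≤ ‖z‖) : ‖((‖z‖⁻¹ : ℝ) : ℂ) * z‖ = 1 := by
  rw [norm_mul, Complex.norm_real, norm_inv, norm_norm,
    inv_mul_cancel₀ (one_pos.trans_le hz).ne']

theorem isForwardInvariant_spiral : spiral.IsForwardInvariant (Metric.closedBall 0 1) := by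
  rintro t _ ⟨z, hz, rfl⟩
  rw [mem_closedBall_zero_iff] at hz ⊢
  rwa [spiral_apply, norm_spiralMap_of_norm_le_one hz]

theorem isAbsorbing_spiral : spiral.IsAbsorbing (Metric.closedBall 0 1) := by
  intro z
  rcases le_total ‖z‖ 1 with hz | hz
  · exact ⟨0, fun t _ => isForwardInvariant_spiral t
      (mem_image_of_mem _ (mem_closedBall_zero_iff.2 hz))⟩
  · obtain ⟨T, hT⟩ := exists_spiral_apply_eq hz
    refine ⟨T, fun t ht => ?_⟩
    rw [hT t ht, mem_closedBall_zero_iff, norm_inv_norm_mul hz]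

theorem ae_diracProba {X : Type u} [MeasurableSpace X] [MeasurableSingletonClass X] {y : X}
    {P : X → Prop} : (∀ᵐ x ∂(diracProba y : Measure X), P x) ↔ P y := by
  change (∀ᵐ x ∂(Measure.dirac y), P x) ↔ P y
  rw [ae_dirac_eq, eventually_pure]

theorem ae_norm_eq_of_mem_omegaMeasure_spiral {y : ℂ} (hy : ‖y‖ ≤ 1) {η : ProbabilityMeasure ℂ}
    (hη : η ∈ spiral.omegaMeasure (diracProba y)) : ∀ᵐ z ∂(η : Measure ℂ), ‖z‖ = ‖y‖ := by
  have hC : IsClosed {z : ℂ | ‖z‖ = ‖y‖} := isClosed_eq continuous_norm continuous_const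
  refine (mem_ae_iff_prob_eq_one hC.measurableSet).2 (measure_eq_one_of_eventually_mem hη hC ?_)
  exact ae_diracProba.2 ⟨0, fun t _ => norm_spiralMap_of_norm_le_one hy t⟩

theorem ae_eq_of_mem_omegaMeasure_spiral {y : ℂ} (hy : 1 ≤ ‖y‖) {η : ProbabilityMeasure ℂ}
    (hη : η ∈ spiral.omegaMeasure (diracProba y)) :
    ∀ᵐ z ∂(η : Measure ℂ), z = (‖y‖⁻¹ : ℝ) * y := by
  refine (mem_ae_iff_prob_eq_one (measurableSet_singleton _)).2
    (measure_eq_one_of_eventually_mem hη isClosed_singleton ?_)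
  exact ae_diracProba.2 (exists_spiral_apply_eq hy)

/-- A point limit of `spiral` carried by the unit circle is a Dirac mass. -/
theorem exists_ae_eq_of_mem_pointLimits_spiral {μ : ProbabilityMeasure ℂ}
    (hμ : μ ∈ spiral.pointLimits) (h1 : ∀ᵐ z ∂(μ : Measure ℂ), ‖z‖ = 1) :
    ∃ p : ℂ, ∀ᵐ z ∂(μ : Measure ℂ), z = p := by
  obtain ⟨y, hy⟩ := mem_iUnion.1 hμ
  rcases lt_or_ge ‖y‖ 1 with hy1 | hy1
  · obtain ⟨z, hz1, hz2⟩ := (h1.and (ae_norm_eq_of_mem_omegaMeasure_spiral hy1.le hy)).exists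
    exact absurd (hz2.symm.trans hz1) hy1.ne
  · exact ⟨_, ae_eq_of_mem_omegaMeasure_spiral hy1 hy⟩

theorem diracProba_mem_pointLimits_spiral {p : ℂ} (hp : ‖p‖ = 1) :
    diracProba p ∈ spiral.pointLimits := by
  refine mem_iUnion.2 ⟨p, ?_⟩
  rw [omegaMeasure_eq_singleton_of_invariant]
  · rfl
  · intro t
    refine ProbabilityMeasure.toMeasure_injective ?_
    rw [coe_pushforward]
    change Measure.map (spiral t) (Measure.dirac p) = Measure.dirac p
    rw [Measure.map_dirac' (spiral.continuous_map t).measurable, spiral_apply_of_norm_eq_one hp]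

/-- The midpoint of the Dirac masses at the fixed points `1` and `-1` lies on the unit circle but is
not a Dirac mass. -/
theorem not_isConvexSet_pointLimits_spiral :
    ¬ ProbabilityMeasure.IsConvexSet spiral.pointLimits := by
  intro h
  have hmem := ProbabilityMeasure.isConvexSet_iff.1 h _
    (diracProba_mem_pointLimits_spiral (p := 1) (by simp)) _
    (diracProba_mem_pointLimits_spiral (p := -1) (by simp)) 2⁻¹ 2⁻¹ (by norm_num)
  have hae : ∀ P : ℂ → Prop, (∀ᵐ z ∂(ProbabilityMeasure.convexCombo 2⁻¹ 2⁻¹ (by norm_num)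
      (diracProba (1 : ℂ)) (diracProba (-1 : ℂ)) : Measure ℂ), P z) ↔ P 1 ∧ P (-1) := by
    intro P
    have h0 : ((2⁻¹ : ℝ≥0) : ℝ≥0∞) ≠ 0 := by simp
    rw [ProbabilityMeasure.coe_convexCombo, ae_add_measure_iff]
    exact and_congr ((Measure.ae_ennreal_smul_measure_iff h0).trans ae_diracProba)
      ((Measure.ae_ennreal_smul_measure_iff h0).trans ae_diracProba)
  obtain ⟨p, hp⟩ := exists_ae_eq_of_mem_pointLimits_spiral hmem ((hae _).2 (by simp))
  obtain ⟨h1, h2⟩ := (hae _).1 hp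
  have := h1.trans h2.symm
  norm_num at this

/-- The measures carried by the circles of radius less than one are invariant under `z ↦ -z`. -/
theorem integral_eq_zero_of_mem_omegaMeasure_spiral {y : ℂ} (hy : ‖y‖ < 1)
    {η : ProbabilityMeasure ℂ} (hη : η ∈ spiral.omegaMeasure (diracProba y)) (F : ℂ →ᵇ ℝ)
    (hF : ∀ z, F (-z) = - F z) : ∫ z, F z ∂(η : Measure ℂ) = 0 := by
  have hpos : 0 < 1 - ‖y‖ := sub_pos.2 hy
  -- At this time the circle of radius `‖y‖` has turned by the angle `π`.
  let t : ℝ≥0 := ⟨Real.pi / (1 - ‖y‖), (div_pos Real.pi_pos hpos).le⟩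
  have h := integral_pushforward spiral t η F
  rw [pushforward_eq_of_mem_omegaMeasure hη] at h
  have h2 : ∫ z, F (spiral t z) ∂(η : Measure ℂ) = ∫ z, - F z ∂(η : Measure ℂ) := by
    refine integral_congr_ae ?_
    filter_upwards [ae_norm_eq_of_mem_omegaMeasure_spiral hy.le hη] with z hz
    have ht : (t : ℝ) * (1 - ‖z‖) = Real.pi := by
      rw [hz]
      exact div_mul_cancel₀ _ hpos.ne'
    rw [spiral_apply, spiralMap_of_norm_le_one (hz.trans_le hy.le), ht, Complex.exp_pi_mul_I,
      neg_one_mul, hF]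
  rw [h2, integral_neg] at h
  linarith

/-- A continuous function clipped to `[-1, 1]`. -/
noncomputable def clip (f : C(ℂ, ℝ)) : ℂ →ᵇ ℝ :=
  BoundedContinuousFunction.ofNormedAddCommGroup (fun z => max (-1) (min 1 (f z)))
    (continuous_const.max (continuous_const.min f.continuous)) 1 fun z => by
      rw [Real.norm_eq_abs, abs_le]
      exact ⟨le_max_left _ _, max_le (by norm_num) (min_le_left _ _)⟩

theorem clip_apply {f : C(ℂ, ℝ)} {z : ℂ} (h : |f z| ≤ 1) : clip f z = f z := by
  change max (-1) (min 1 (f z)) = f z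
  rw [abs_le] at h
  rw [min_eq_right h.2, max_eq_right h.1]

theorem clip_neg {f : C(ℂ, ℝ)} (h : ∀ z, f (-z) = - f z) (z : ℂ) : clip f (-z) = - clip f z := by
  change max (-1) (min 1 (f (-z))) = - max (-1) (min 1 (f z))
  rw [h]
  rcases le_total (f z) 1 with h1 | h1 <;> rcases le_total (-1) (f z) with h2 | h2 <;>
    grind

/-- Point limits on circles of radii increasing to `1` have a weak limit `μ` that annihilates odd
functions and has mean radius `1`. If `μ` were in `ω(δ_w)`, then `‖w‖ < 1` would make the mean
radius `‖w‖`, while `‖w‖ ≥ 1` would make `μ` a Dirac mass at a unit vector `p`, giving the odd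
function `Re (z * conj p)` the integral `1`. -/
theorem not_isClosed_pointLimits_spiral : ¬ IsClosed spiral.pointLimits := by
  intro hcl
  have hK : IsCompact (Metric.closedBall (0 : ℂ) 1) := isCompact_closedBall 0 1
  let y : ℕ → ℂ := fun n => ((1 - ((n : ℝ) + 1)⁻¹ : ℝ) : ℂ)
  have hny : ∀ n, ‖y n‖ = 1 - ((n : ℝ) + 1)⁻¹ := fun n => by
    rw [Complex.norm_real, Real.norm_of_nonneg]
    exact sub_nonneg.2 (inv_le_one_of_one_le₀ (by simp))
  have hy : ∀ n, ‖y n‖ < 1 := fun n => by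
    rw [hny]
    exact sub_lt_self _ (by positivity)
  choose m hm using fun n => omegaMeasure_nonempty (R := spiral) hK isForwardInvariant_spiral
    (diracProba_apply_eq_one hK.isClosed (mem_closedBall_zero_iff.2 (hy n).le))
  obtain ⟨μ, -, φ, hφ, hlim⟩ := (isCompact_invariantMeasures (R := spiral) hK).tendsto_subseq
    fun n => omegaMeasure_subset_invariantMeasures hK.isClosed isAbsorbing_spiral _ (hm n)
  have hμ : μ ∈ spiral.pointLimits :=
    hcl.mem_of_tendsto hlim (Eventually.of_forall fun n => mem_iUnion.2 ⟨_, hm (φ n)⟩)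
  have hint := ProbabilityMeasure.tendsto_iff_forall_integral_tendsto.1 hlim
  have hodd : ∀ f : C(ℂ, ℝ), (∀ z, f (-z) = - f z) → ∫ z, clip f z ∂(μ : Measure ℂ) = 0 := by
    intro f hf
    refine tendsto_nhds_unique (hint (clip f)) (tendsto_const_nhds.congr fun n => ?_)
    exact (integral_eq_zero_of_mem_omegaMeasure_spiral (hy _) (hm _) _ (clip_neg hf)).symm
  obtain ⟨w, hw⟩ := mem_iUnion.1 hμ
  rcases lt_or_ge ‖w‖ 1 with hw1 | hw1
  · let f : C(ℂ, ℝ) := ⟨fun z => ‖z‖, continuous_norm⟩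
    have h1 : ∀ {v : ℂ} {η : ProbabilityMeasure ℂ}, ‖v‖ ≤ 1 →
        η ∈ spiral.omegaMeasure (diracProba v) → ∫ z, clip f z ∂(η : Measure ℂ) = ‖v‖ := by
      intro v η hv hη
      have : ∫ z, clip f z ∂(η : Measure ℂ) = ∫ _z, ‖v‖ ∂(η : Measure ℂ) := by
        refine integral_congr_ae ?_
        filter_upwards [ae_norm_eq_of_mem_omegaMeasure_spiral hv hη] with z hz
        have hfz : f z = ‖v‖ := hz
        rw [clip_apply (by rw [hfz, abs_norm]; exact hv), hfz]
      rw [this]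
      simp
    have h2 := hint (clip f)
    rw [h1 hw1.le hw] at h2
    have h3 : Tendsto (fun n => ‖y (φ n)‖) atTop (𝓝 1) := by
      have : Tendsto (fun n : ℕ => 1 - ((n : ℝ) + 1)⁻¹) atTop (𝓝 1) := by
        simpa using (tendsto_one_div_add_atTop_nhds_zero_nat (𝕜 := ℝ)).const_sub 1
      simp_rw [hny]
      exact this.comp hφ.tendsto_atTop
    refine hw1.ne (tendsto_nhds_unique h2 (h3.congr fun n => ?_))
    exact (h1 (hy _).le (hm _)).symm
  · set p : ℂ := (‖w‖⁻¹ : ℝ) * w with hp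
    have hpn : ‖p‖ = 1 := norm_inv_norm_mul hw1
    have hae := ae_eq_of_mem_omegaMeasure_spiral hw1 hw
    let f : C(ℂ, ℝ) := ⟨fun z => (z * (starRingEnd ℂ) p).re, by fun_prop⟩
    have hfp : f p = 1 := by
      change (p * (starRingEnd ℂ) p).re = 1
      rw [Complex.mul_conj, Complex.ofReal_re, Complex.normSq_eq_norm_sq, hpn, one_pow]
    have h1 : ∫ z, clip f z ∂(μ : Measure ℂ) = ∫ _z, (1 : ℝ) ∂(μ : Measure ℂ) := by
      refine integral_congr_ae ?_
      filter_upwards [hae] with z hz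
      rw [hz, ← hp, clip_apply (by rw [hfp, abs_one]), hfp]
    rw [hodd f (fun z => by change (-z * _).re = -(z * _).re; rw [neg_mul, Complex.neg_re])] at h1
    simp at h1

end SpiralFlow

theorem theorem3 :
    (∀ (H : Type u) [TopologicalSpace H] [PolishSpace H] [MeasurableSpace H] [BorelSpace H]
      (R : ContinuousSemigroup H) (K : Set H),
      IsCompact K → R.IsForwardInvariant K → R.IsAbsorbing K →
      (∀ μ : ProbabilityMeasure H, (μ : Measure H) K = 1 →
        (R.omegaMeasure μ).Nonempty ∧ IsCompact (R.omegaMeasure μ) ∧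
        R.pushforward.IsForwardInvariant (R.omegaMeasure μ) ∧
        ContinuousSemigroup.IsStatisticalAttractor R.pushforward (R.omegaMeasure μ)) ∧
      (∀ y : H, R.omegaMeasure (diracProba y) = R.limitMeasures y) ∧
      R.pointLimits = (⋃ y : H, R.limitMeasures y) ∧
      R.ergodicSet = {μ | R.IsErgodicMeasure μ} ∧
      R.ergodicSet ⊆ R.pointLimits ∧
      R.pointLimits ⊆ R.measureLimits ∧
      R.measureLimits = R.invariantMeasures K ∧
      R.invariantMeasures K = ProbabilityMeasure.closedHull R.ergodicSet ∧
      IsCompact R.measureLimits ∧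
      ProbabilityMeasure.IsConvexSet R.measureLimits) ∧
    -- the set of point limits is neither closed nor convex in general
    (∃ (R : ContinuousSemigroup ℂ) (K : Set ℂ),
      IsCompact K ∧ R.IsForwardInvariant K ∧ R.IsAbsorbing K ∧
      ¬ IsClosed R.pointLimits ∧ ¬ ProbabilityMeasure.IsConvexSet R.pointLimits) := by
  refine ⟨fun H _ _ _ _ R K hK hinv habs => ?_, spiral, Metric.closedBall 0 1,
    isCompact_closedBall 0 1, isForwardInvariant_spiral, isAbsorbing_spiral,
    not_isClosed_pointLimits_spiral, not_isConvexSet_pointLimits_spiral⟩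
  have hlim := ContinuousSemigroup.measureLimits_eq_invariantMeasures hK.isClosed habs
  refine ⟨fun μ hμ => ⟨ContinuousSemigroup.omegaMeasure_nonempty hK hinv hμ,
      ContinuousSemigroup.isCompact_omegaMeasure hK habs μ, R.isForwardInvariant_omegaMeasure μ,
      ContinuousSemigroup.isStatisticalAttractor_omegaMeasure hK hinv habs hμ⟩,
    R.omegaMeasure_dirac, iUnion_congr R.omegaMeasure_dirac,
    ContinuousSemigroup.ergodicSet_eq hK hinv habs,
    R.ergodicSet_subset_pointLimits, R.pointLimits_subset_measureLimits, hlim,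
    ContinuousSemigroup.invariantMeasures_eq_closedHull hK hinv habs, ?_, ?_⟩
  · rw [hlim]
    exact ContinuousSemigroup.isCompact_invariantMeasures hK
  · rw [hlim]
    exact R.isConvexSet_invariantMeasures K
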